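/- Let $a=\mathrm{diag}(i,-i)$, $b=-a/4$, let $q:\mathbb R^2\to\mathbb R$ be a smooth solution of the sine-Gordon equation $q_{xt}=\sin q$, let $s\in\mathbb R\setminus\{0\}$ and $c_0\in\mathbb R$, and put $$u=\begin{pmatrix}0&q_x/2\\-q_x/2&0\end{pmatrix},\qquad f_0=\tfrac12\,(q(0,0)+c_0),\qquad z=is,$$ $$\pi=\begin{pmatrix}\cos^2\frac{f_0}{2}&\sin\frac{f_0}{2}\cos\frac{f_0}{2}\\ \sin\frac{f_0}{2}\cos\frac{f_0}{2}&\sin^2\frac{f_0}{2}\end{pmatrix},\qquad g_{z,\pi}(\lambda)=\pi+\frac{\lambda-z}{\lambda-\bar z}(I-\pi).$$ Then $\pi$ is the Hermitian projection of $\mathbb C^2$ onto the line spanned by $(\cos\frac{f_0}2,\sin\frac{f_0}2)^t$; the loop $g_{is,\pi}$ is rational, equals $I$ at $\infty$, and satisfies $g(\bar\lambda)^*g(\lambda)=I$ and $g(-\lambda)^tg(\lambda)=I$. The function $u$ takes values in $\{y\in su(2): -y^t=y,\ \mathrm{tr}(ay)=0\}$ and solves the $-1$ flow $u_t=[a,g^{-1}bg]$,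 $g^{-1}g_x=u$, with the frame $g=\begin{pmatrix}\cos\frac q2&\sin\frac q2\\-\sin\frac q2&\cos\frac q2\end{pmatrix}$. If for every $t$ the limit of $q(x,t)$ as $x\to-\infty$ exists and lies in $2\pi\mathbb Z$, then $u$ also solves it with a frame normalized by $\lim_{x\to-\infty}g(x,t)=I$. In what follows $g$ is the first of these frames or, under this condition on $q$, any frame of $u$ for the $-1$ flow that is so normalized. Let $E(x,t,\lambda)$, $\lambda\in\mathbb C\setminus\{0\}$, be the trivialization of $u$: $E_x=E(a\lambda+u)$, $E_t=E\lambda^{-1}g^{-1}bg$, $E(0,0,\lambda)=I$. Write $\tilde u=g_{is,\pi}\ast u$ if $g_{is,\pi}E(x,t)=\tilde E(x,t)\,\tilde g(x,t)$ for all $(x,t)$, where $\tilde E(x,t)$ is a holomorphic map $\mathbb C\setminus\{0\}\to GL(2,\mathbb C)$, $\tilde g(x,t)$ is a rational map equal to $I$ at $\infty$, both satisfy $h(\bar\lambda)^*h(\lambda)=I$, and $\tilde E^{-1}\tilde E_x=a\lambda+\tilde u$. (1) There is exactly one function $q^*=B_{s,c_0}(q)$ on $\mathbb R^2$ (the classical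 Bäcklund transform of $q$) with $$(q^*-q)_x=4s\sin\frac{q^*+q}{2},\qquad (q^*+q)_t=\frac1s\sin\frac{q^*-q}{2},\qquad q^*(0,0)=c_0,$$ and it is again a smooth solution of the sine-Gordon equation. (2) $g_{is,\pi}\ast u$ exists, is unique, and corresponds to $B_{s,c_0}(q)$: $$g_{is,\pi}\ast u=\begin{pmatrix}0&q^*_x/2\\-q^*_x/2&0\end{pmatrix}.$$ (3) Let $\tilde\pi(x,t)$ be the Hermitian projection onto $E(x,t,is)^*(\pi(\mathbb C^2))$. Then $\tilde\pi$ is the real Hermitian projection onto the line spanned by $(\cos\frac f2,\sin\frac f2)^t$ with $f=\frac12(q^*+q)$, $g_{is,\pi}\ast u=u+(z-\bar z)[\tilde\pi,a]$, and $\tilde\pi$ is the unique solution of $$\tilde\pi_x+[az+u,\tilde\pi]=(\bar z-z)[\tilde\pi,a]\tilde\pi,\qquad \tilde\pi_t=\frac1{|z|^2}\left((z-\bar z)\tilde\pi g^{-1}bg\tilde\pi-zg^{-1}bg\tilde\pi+\bar z\tilde\pi g^{-1}bg\right),$$ $\tilde\pi^*=\tilde\pi$, $\tilde\pi^2=\tilde\pi$,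 $\tilde\pi(0,0)=\pi$. This system reduces to the classical one: if $f:\mathbb R^2\to\mathbb R$ is differentiable in $x$ and in $t$ and $f(0,0)=f_0$, then the Hermitian projections onto the lines spanned by $(\cos\frac{f}{2},\sin\frac{f}{2})^t$ solve it if and only if $2f-q$ satisfies the system in (1). -/

import Mathlib

open scoped ContDiff Topology

noncomputable section

namespace LoopSG

variable {n : Type*} [Fintype n] [DecidableEq n]

/-! ### Loop groups -/

/-- `F` has derivative `F'` at `x`, entry by entry. -/
def HasMatDerivAt (F : ℝ → Matrix n n ℂ) (F' : Matrix n n ℂ) (x : ℝ) : Prop :=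
  ∀ i j, HasDerivAt (fun y => F y i j) (F' i j) x

/-- The group of holomorphic maps `ℂ ∖ {0} → GL(n, ℂ)` with the `U(n)`-reality condition
`f(conj l)^* f(l) = 1` (the value at `0` is irrelevant). -/
structure IsPlusLoop (f : ℂ → Matrix n n ℂ) : Prop where
  holomorphic : ∀ i j, DifferentiableOn ℂ (fun l => f l i j) {0}ᶜ
  invertible : ∀ l, l ≠ 0 → IsUnit (f l).det
  reality : ∀ l, l ≠ 0 → (f (star l)).conjTranspose * f l = 1

/-- The group of rational maps `g` into `GL(n, ℂ)` that are holomorphic at `∞` with `g(∞) = 1`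
and satisfy the `U(n)`-reality condition. A rational map is represented by a function on `ℂ`;
its values at finitely many points (the poles in particular) are irrelevant. -/
structure IsRationalLoop (g : ℂ → Matrix n n ℂ) : Prop where
  rational : ∃ (d : Polynomial ℂ) (P : Matrix n n (Polynomial ℂ)), d ≠ 0 ∧
    ∀ l, d.eval l ≠ 0 → ∀ i j, g l i j = (P i j).eval l / d.eval l
  at_infinity : Filter.Tendsto g (Filter.cocompact ℂ) (𝓝 1)
  reality : ∀ᶠ l in Filter.cofinite, (g (star l)).conjTranspose * g l = 1

/-- Rational loops with, in addition, `σ(g(-l)) = g(l)` for the involution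
`σ(y) = (yᵗ)⁻¹`. -/
structure IsTwistedRationalLoop (g : ℂ → Matrix n n ℂ) : Prop extends IsRationalLoop g where
  twisted : ∀ᶠ l in Filter.cofinite, (g (-l)).transpose * g l = 1

/-- `p` is the Hermitian projection of `ℂⁿ` onto `V`. -/
structure IsHermitianProjectionOnto (p : Matrix n n ℂ) (V : Submodule ℂ (n → ℂ)) : Prop where
  hermitian : p.conjTranspose = p
  idempotent : p * p = p
  range_eq : LinearMap.range (Matrix.toLin' p) = V

/-- The simple element `g_{z,p}(l) = p + ((l - z) / (l - conj z)) (1 - p)`. -/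
def simpleElement (z : ℂ) (p : Matrix n n ℂ) (l : ℂ) : Matrix n n ℂ :=
  p + ((l - z) / (l - star z)) • (1 - p)

/-! ### The `-1` flow, its trivialization, and the dressing action -/

/-- The space of `y ∈ su(n)` with `-yᵗ = y` and `tr (a y) = 0`. -/
def twistedPerp (a : Matrix n n ℂ) : Set (Matrix n n ℂ) :=
  {y | y.conjTranspose = -y ∧ y.trace = 0 ∧ -y.transpose = y ∧ (a * y).trace = 0}

/-- `u` solves the `-1` flow `u_t = [a, g⁻¹ b g]`, `g⁻¹ g_x = u`, with frame `g`. -/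
structure IsMinusOneFlow (a b : Matrix n n ℂ) (u g : ℝ → ℝ → Matrix n n ℂ) : Prop where
  smooth : ∀ i j, ContDiff ℝ ∞ (fun p : ℝ × ℝ => u p.1 p.2 i j)
  frame_invertible : ∀ x t, IsUnit (g x t).det
  frame_x : ∀ x t, HasMatDerivAt (fun y => g y t) (g x t * u x t) x
  flow : ∀ x t, HasMatDerivAt (fun τ => u x τ)
    (a * ((g x t)⁻¹ * b * g x t) - ((g x t)⁻¹ * b * g x t) * a) t

/-- The normalization `g → 1` as `x → -∞` of the frame. -/
def IsNormalizedFrame (g : ℝ → ℝ → Matrix n n ℂ) : Prop :=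
  ∀ t, Filter.Tendsto (fun x => g x t) Filter.atBot (𝓝 1)

/-- `E` is the trivialization, normalized at `(0,0)`, of the Lax pair of the `-1` flow:
`E_x = E (a l + u)`, `E_t = E (l⁻¹ g⁻¹ b g)`, `E(0,0,l) = 1`, for `l ≠ 0`. -/
structure IsTrivialization (a b : Matrix n n ℂ) (u g : ℝ → ℝ → Matrix n n ℂ)
    (E : ℝ → ℝ → ℂ → Matrix n n ℂ) : Prop where
  base : ∀ l, l ≠ 0 → E 0 0 l = 1
  deriv_x : ∀ x t l, l ≠ 0 → HasMatDerivAt (fun y => E y t l) (E x t l * (l • a + u x t)) x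
  deriv_t : ∀ x t l, l ≠ 0 →
    HasMatDerivAt (fun τ => E x τ l) (E x t l * (l⁻¹ • ((g x t)⁻¹ * b * g x t))) t

/-- `v = k ∗ u`: with `E` the trivialization of `u`, the loop `k E(x,t)` is factored as
`F(x,t) m(x,t)`, with `F(x,t)` holomorphic on `ℂ ∖ {0}` and `m(x,t)` rational (both real), and
`F⁻¹ F_x = a l + v`. -/
def IsDressing (a b : Matrix n n ℂ) (u g : ℝ → ℝ → Matrix n n ℂ) (k : ℂ → Matrix n n ℂ)
    (v : ℝ → ℝ → Matrix n n ℂ) : Prop :=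
  ∃ (E F m : ℝ → ℝ → ℂ → Matrix n n ℂ),
    IsTrivialization a b u g E ∧
    (∀ x t, IsPlusLoop (F x t)) ∧
    (∀ x t, IsRationalLoop (m x t)) ∧
    (∀ x t, ∀ᶠ l in Filter.cofinite, k l * E x t l = F x t l * m x t l) ∧
    (∀ x t l, l ≠ 0 → HasMatDerivAt (fun y => F y t l) (F x t l * (l • a + v x t)) x)

/-- The first order system for the projection `P`, with parameter `z` and initial
condition `p`. -/
structure IsProjectionSystem (a b : Matrix n n ℂ) (u g : ℝ → ℝ → Matrix n n ℂ) (z : ℂ)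
    (p : Matrix n n ℂ) (P : ℝ → ℝ → Matrix n n ℂ) : Prop where
  deriv_x : ∀ x t, HasMatDerivAt (fun y => P y t)
    ((star z - z) • ((P x t * a - a * P x t) * P x t)
      - ((z • a + u x t) * P x t - P x t * (z • a + u x t))) x
  deriv_t : ∀ x t, HasMatDerivAt (fun τ => P x τ)
    (((‖z‖ ^ 2 : ℝ) : ℂ)⁻¹ •
      ((z - star z) • (P x t * ((g x t)⁻¹ * b * g x t) * P x t)
        - z • (((g x t)⁻¹ * b * g x t) * P x t)
        + star z • (P x t * ((g x t)⁻¹ * b * g x t)))) t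
  hermitian : ∀ x t, (P x t).conjTranspose = P x t
  idempotent : ∀ x t, P x t * P x t = P x t
  base : P 0 0 = p

/-! ### The sine-Gordon equation -/

/-- `q` is a smooth solution on `ℝ²` of `q_{xt} = sin q`. -/
structure IsSineGordon (q : ℝ → ℝ → ℝ) : Prop where
  smooth : ContDiff ℝ ∞ (fun p : ℝ × ℝ => q p.1 p.2)
  eqn : ∀ x t, deriv (fun τ => deriv (fun y => q y τ) x) t = Real.sin (q x t)

/-- `r` is a solution of the classical Bäcklund system of `q` with parameter `s`
and `r(0,0) = c`. -/
structure IsClassicalBacklund (s c : ℝ) (q r : ℝ → ℝ → ℝ) : Prop where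
  deriv_x : ∀ x t, HasDerivAt (fun y => r y t - q y t)
    (4 * s * Real.sin ((r x t + q x t) / 2)) x
  deriv_t : ∀ x t, HasDerivAt (fun τ => r x τ + q x τ)
    (1 / s * Real.sin ((r x t - q x t) / 2)) t
  base : r 0 0 = c

/-- `a = diag(i, -i)`. -/
def sgA : Matrix (Fin 2) (Fin 2) ℂ := !![Complex.I, 0; 0, -Complex.I]

/-- `b = -a/4`. -/
def sgB : Matrix (Fin 2) (Fin 2) ℂ := (-(1 / 4) : ℂ) • sgA

/-- `u = [[0, q_x/2], [-q_x/2, 0]]`. -/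
def sgPotential (q : ℝ → ℝ → ℝ) (x t : ℝ) : Matrix (Fin 2) (Fin 2) ℂ :=
  !![0, ((deriv (fun y => q y t) x / 2 : ℝ) : ℂ);
     ((-(deriv (fun y => q y t) x / 2) : ℝ) : ℂ), 0]

/-- The frame `exp ((q/2) J)`, `J = [[0, 1], [-1, 0]]`. -/
def sgFrame (q : ℝ → ℝ → ℝ) (x t : ℝ) : Matrix (Fin 2) (Fin 2) ℂ :=
  !![((Real.cos (q x t / 2) : ℝ) : ℂ), ((Real.sin (q x t / 2) : ℝ) : ℂ);
     ((-Real.sin (q x t / 2) : ℝ) : ℂ), ((Real.cos (q x t / 2) : ℝ) : ℂ)]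

/-- The boundary condition `q(x,t) → 0` modulo `2π` as `x → -∞`. -/
def VanishesAtBot (q : ℝ → ℝ → ℝ) : Prop :=
  ∀ t, ∃ k : ℤ, Filter.Tendsto (fun x => q x t) Filter.atBot (𝓝 (2 * Real.pi * k))

/-- The frames through which a sine-Gordon solution `q` is viewed as a solution of the `-1` flow:
the frame `exp ((q/2) J)`, which needs no condition at `x = -∞`, and, if `q → 0` modulo `2π` there,
every frame normalized by `g → 1`. -/
def IsSineGordonFrame (q : ℝ → ℝ → ℝ) (g : ℝ → ℝ → Matrix (Fin 2) (Fin 2) ℂ) : Prop :=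
  IsMinusOneFlow sgA sgB (sgPotential q) g ∧
    (g = sgFrame q ∨ (VanishesAtBot q ∧ IsNormalizedFrame g))

/-- The complex line spanned by `(cos (f/2), sin (f/2))`. -/
def angleLine (f : ℝ) : Submodule ℂ (Fin 2 → ℂ) :=
  Submodule.span ℂ {![((Real.cos (f / 2) : ℝ) : ℂ), ((Real.sin (f / 2) : ℝ) : ℂ)]}

/-- The matrix of the Hermitian projection onto `angleLine f`. -/
def angleProj (f : ℝ) : Matrix (Fin 2) (Fin 2) ℂ :=
  !![((Real.cos (f / 2) ^ 2 : ℝ) : ℂ), ((Real.sin (f / 2) * Real.cos (f / 2) : ℝ) : ℂ);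
     ((Real.sin (f / 2) * Real.cos (f / 2) : ℝ) : ℂ), ((Real.sin (f / 2) ^ 2 : ℝ) : ℂ)]

end LoopSG

end

open LoopSG

/-! Everything is expressed through the angle f = (q* + q)/2 and the reflection R(f) = 2π̃ - 1. In
terms of f the classical system reads f_x = q_x + 2s sin f, f_t = sin(f - q)/(2s)
(`IsBacklundAngle`). Since z = is is purely imaginary, clearing the denominator of the simple
element with projection π̃ gives the Darboux matrix M = l + zR(f). The system for f says exactly
that M intertwines the Lax pairs of q and of 2f - q.

Hence E' M E⁻¹ is constant, E and E' being the trivializations of q and 2f - q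
(`IsBacklundAngle.gauge`). Dividing by l - conj z yields the factorization that defines the dressing
action. It is unique by a Liouville argument (`IsPlusLoop.eq_of_factorization`): the quotient of two
plus factors is bounded on the real axis by unitarity, so it has no pole at 0, and it tends to 1 at
∞. At l = z, M degenerates to 2zπ̃, which identifies the range of π̃.

Existence of f and of E is obtained from ordinary differential equations: solve in t along x = 0,
then in x for each t, and recover the t-equation by differentiating in the parameter t
(`hasDerivAt_parameter_of_approx`). The candidate for the t-derivative satisfies the linearized
x-equation precisely because q_xt = sin q.

The choice of frame is harmless: every admissible one is the frame exp((q/2)J) up to a sign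
depending on t, so g⁻¹bg = -(i/4)R(q) always. Inserting π̃ = (1 + R(f))/2 turns the projection
system into the angle system, and its uniqueness follows because the difference of two solutions
satisfies a linear homogeneous equation. -/

namespace LoopSG

/-! ### Ordinary differential equations: uniqueness, global existence, parameters -/

section ODE

variable {V : Type*} [NormedAddCommGroup V] [NormedSpace ℝ V]

/-- Grönwall's inequality on a symmetric interval. -/
theorem norm_le_gronwallBound_abs {f f' : ℝ → V} {δ K ε R : ℝ}
    (hf : ∀ x, |x| ≤ R → HasDerivAt f (f' x) x) (h0 : ‖f 0‖ ≤ δ)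
    (bound : ∀ x, |x| ≤ R → ‖f' x‖ ≤ K * ‖f x‖ + ε) (x : ℝ) (hx : |x| ≤ R) :
    ‖f x‖ ≤ gronwallBound δ K ε |x| := by
  have key : ∀ g g' : ℝ → V, (∀ x, |x| ≤ R → HasDerivAt g (g' x) x) → ‖g 0‖ ≤ δ →
      (∀ x, |x| ≤ R → ‖g' x‖ ≤ K * ‖g x‖ + ε) → ∀ x, 0 ≤ x → x ≤ R →
      ‖g x‖ ≤ gronwallBound δ K ε x := by
    intro g g' hg hg0 hb x hx0 hxR
    have habs : ∀ y ∈ Set.Icc (0 : ℝ) R, |y| ≤ R := fun y hy => by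
      rw [abs_of_nonneg hy.1]; exact hy.2
    have := norm_le_gronwallBound_of_norm_deriv_right_le (f := g) (f' := g') (δ := δ) (K := K)
      (ε := ε) (a := 0) (b := R)
      (fun y hy => (hg y (habs y hy)).continuousAt.continuousWithinAt)
      (fun y hy => (hg y (habs y ⟨hy.1, hy.2.le⟩)).hasDerivWithinAt) hg0
      (fun y hy => hb y (habs y ⟨hy.1, hy.2.le⟩)) x ⟨hx0, hxR⟩
    simpa using this
  rcases le_total 0 x with h | h
  · rw [abs_of_nonneg h] at hx ⊢
    exact key f f' hf h0 bound x h hx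
  · rw [abs_of_nonpos h] at hx ⊢
    have := key (fun y => f (-y)) (fun y => -f' (-y)) (fun y hy => ?_) (by simpa using h0)
      (fun y hy => ?_) (-x) (by linarith) hx
    · simpa using this
    · exact ((hf (-y) (by rwa [abs_neg])).scomp y (hasDerivAt_neg y)).congr_deriv (by simp)
    · simpa using bound (-y) (by rwa [abs_neg])

/-- A function vanishing at `0` whose derivative is locally dominated by the function is zero. -/
theorem eq_zero_of_norm_deriv_le {f f' : ℝ → V} (hf : ∀ x, HasDerivAt f (f' x) x) (h0 : f 0 = 0)
    (bound : ∀ R, ∃ K, ∀ x, |x| ≤ R → ‖f' x‖ ≤ K * ‖f x‖) (x : ℝ) : f x = 0 := by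
  obtain ⟨K, hK⟩ := bound |x|
  have := norm_le_gronwallBound_abs (f := f) (f' := f') (δ := 0) (K := K) (ε := 0) (R := |x|)
    (fun x _ => hf x) (by simp [h0]) (by simpa using hK) x le_rfl
  rw [gronwallBound_ε0_δ0] at this
  exact norm_le_zero_iff.mp this

/-- Integrating a bound C|x|ⁿ/n! once. Iterated, it gives the factorial decay of Picard differences;
with n = 0 and n = 1 it supplies the Lipschitz and Taylor estimates below. -/
theorem norm_le_pow_div_factorial {g g' : ℝ → V} {C R : ℝ} (n : ℕ)
    (hg : ∀ x, HasDerivAt g (g' x) x) (h0 : g 0 = 0)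
    (bound : ∀ x, |x| ≤ R → ‖g' x‖ ≤ C * (|x| ^ n / n.factorial)) (x : ℝ) (hx : |x| ≤ R) :
    ‖g x‖ ≤ C * (|x| ^ (n + 1) / (n + 1).factorial) := by
  have key : ∀ g g' : ℝ → V, (∀ x, HasDerivAt g (g' x) x) → g 0 = 0 →
      (∀ x, |x| ≤ R → ‖g' x‖ ≤ C * (|x| ^ n / n.factorial)) → ∀ x, 0 ≤ x → x ≤ R →
      ‖g x‖ ≤ C * (x ^ (n + 1) / (n + 1).factorial) := by
    intro g g' hg hg0 hb x hx0 hxR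
    refine image_norm_le_of_norm_deriv_right_le_deriv_boundary (f := g) (f' := g') (a := 0) (b := R)
      (B := fun x => C * (x ^ (n + 1) / (n + 1).factorial))
      (B' := fun x => C * (x ^ n / n.factorial))
      (fun y _ => (hg y).continuousAt.continuousWithinAt) (fun y _ => (hg y).hasDerivWithinAt)
      (by simp [hg0]) (fun y => ?_) (fun y hy => ?_) ⟨hx0, hxR⟩
    · have := ((hasDerivAt_pow (n + 1) y).div_const ((n + 1).factorial : ℝ)).const_mul C
      refine this.congr_deriv ?_
      have h1 : (n.factorial : ℝ) ≠ 0 := by positivity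
      have h2 : (n + 1 : ℝ) ≠ 0 := by positivity
      rw [Nat.factorial_succ]
      push_cast
      field_simp
    · have := hb y (by rw [abs_of_nonneg hy.1]; exact hy.2.le)
      rwa [abs_of_nonneg hy.1] at this
  rcases le_total 0 x with h | h
  · rw [abs_of_nonneg h] at hx ⊢
    exact key g g' hg h0 bound x h hx
  · rw [abs_of_nonpos h] at hx ⊢
    have := key (fun y => g (-y)) (fun y => -g' (-y)) (fun y => ?_) (by simpa using h0)
      (fun y hy => ?_) (-x) (by linarith) hx
    · simpa using this
    · exact ((hg (-y)).scomp y (hasDerivAt_neg y)).congr_deriv (by simp)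
    · simpa using bound (-y) (by rwa [abs_neg])

/-- The Picard iterates of `y' = v(τ, y)`, `y(0) = y₀`. -/
noncomputable def picardIterate (v : ℝ → V → V) (y₀ : V) : ℕ → ℝ → V
  | 0 => fun _ => y₀
  | n + 1 => fun τ => y₀ + ∫ σ in (0 : ℝ)..τ, v σ (picardIterate v y₀ n σ)

/-- Global existence of solutions of `y' = v(τ, y)` for a continuous vector field that is Lipschitz
in `y`, locally uniformly in `τ`. -/
theorem exists_global_solution [CompleteSpace V] {v : ℝ → V → V}
    (hc : Continuous (fun p : ℝ × V => v p.1 p.2))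
    (hl : ∀ R, ∃ K, ∀ τ, |τ| ≤ R → ∀ y y', ‖v τ y - v τ y'‖ ≤ K * ‖y - y'‖) (y₀ : V) :
    ∃ y : ℝ → V, y 0 = y₀ ∧ ∀ τ, HasDerivAt y (v τ (y τ)) τ := by
  set Y := picardIterate v y₀ with hY
  have hY0 : ∀ n, Y n 0 = y₀ := by
    intro n; cases n <;> simp [hY, picardIterate]
  have hYcont : ∀ n, Continuous (Y n) := by
    intro n
    induction n with
    | zero => exact continuous_const
    | succ n ih =>
      have : Continuous fun σ => v σ (Y n σ) := hc.comp (continuous_id.prodMk ih)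
      exact continuous_const.add (intervalIntegral.continuous_primitive
        (fun a b => this.intervalIntegrable a b) 0)
  have hYd : ∀ n τ, HasDerivAt (Y (n + 1)) (v τ (Y n τ)) τ := by
    intro n τ
    have : Continuous fun σ => v σ (Y n σ) := hc.comp (continuous_id.prodMk (hYcont n))
    exact (intervalIntegral.integral_hasDerivAt_right (this.intervalIntegrable _ _)
      this.stronglyMeasurable.stronglyMeasurableAtFilter this.continuousAt).const_add y₀
  -- geometric-factorial bound on differences, on each symmetric interval
  have hbound : ∀ R, ∃ u : ℕ → ℝ, Summable u ∧ ∀ n τ, |τ| ≤ R → ‖Y (n + 1) τ - Y n τ‖ ≤ u n := by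
    intro R
    obtain ⟨K, hK⟩ := hl R
    have hK : ∀ τ, |τ| ≤ R → ∀ y y', ‖v τ y - v τ y'‖ ≤ |K| * ‖y - y'‖ := fun τ hτ y y' =>
      (hK τ hτ y y').trans (mul_le_mul_of_nonneg_right (le_abs_self K) (norm_nonneg _))
    obtain ⟨B, hB⟩ := (isCompact_Icc (a := -R) (b := R)).exists_bound_of_continuousOn
      (f := fun τ => v τ y₀) (hc.comp (continuous_id.prodMk continuous_const)).continuousOn
    have hB : ∀ τ, |τ| ≤ R → ‖v τ y₀‖ ≤ |B| := fun τ hτ =>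
      (hB τ (abs_le.mp hτ)).trans (le_abs_self B)
    have main : ∀ n τ, |τ| ≤ R →
        ‖Y (n + 1) τ - Y n τ‖ ≤ (|B| * |K| ^ n) * (|τ| ^ (n + 1) / (n + 1).factorial) := by
      intro n
      induction n with
      | zero =>
        refine norm_le_pow_div_factorial 0 (g' := fun τ => v τ y₀) (fun τ => ?_) (by simp [hY0])
          (fun τ hτ => by simpa using hB τ hτ)
        exact (hYd 0 τ).sub_const y₀
      | succ n ih =>
        refine norm_le_pow_div_factorial (n + 1) (g' := fun τ => v τ (Y (n + 1) τ) - v τ (Y n τ))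
          (fun τ => (hYd (n + 1) τ).sub (hYd n τ)) (by simp [hY0]) (fun τ hτ => ?_)
        refine (hK τ hτ _ _).trans ?_
        calc |K| * ‖Y (n + 1) τ - Y n τ‖
            ≤ |K| * ((|B| * |K| ^ n) * (|τ| ^ (n + 1) / (n + 1).factorial)) :=
              mul_le_mul_of_nonneg_left (ih τ hτ) (abs_nonneg K)
          _ = _ := by ring
    refine ⟨fun n => (|B| * |R|) * ((|K| * |R|) ^ n / n.factorial),
      (Real.summable_pow_div_factorial _).mul_left _, fun n τ hτ => (main n τ hτ).trans ?_⟩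
    have hτ' : |τ| ≤ |R| := hτ.trans (le_abs_self R)
    calc (|B| * |K| ^ n) * (|τ| ^ (n + 1) / (n + 1).factorial)
        ≤ (|B| * |K| ^ n) * (|R| ^ (n + 1) / n.factorial) := by
          gcongr
          exact Nat.le_succ n
      _ = _ := by ring
  choose u hu hu' using hbound
  have hcauchy : ∀ R τ, |τ| ≤ R → ∃ l, Filter.Tendsto (fun n => Y n τ) Filter.atTop (𝓝 l) := by
    intro R τ hτ
    refine cauchySeq_tendsto_of_complete (cauchySeq_of_summable_dist ?_)
    refine Summable.of_nonneg_of_le (fun _ => dist_nonneg) (fun n => ?_) (hu R)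
    rw [dist_comm, dist_eq_norm]
    exact hu' R n τ hτ
  choose y hy using fun τ : ℝ => hcauchy |τ| τ le_rfl
  have htail : ∀ R τ, |τ| ≤ R → ∀ n, ‖Y n τ - y τ‖ ≤ ∑' m, u R (n + m) := by
    intro R τ hτ n
    rw [← dist_eq_norm]
    refine dist_le_tsum_of_dist_le_of_tendsto (u R) (fun n => ?_) (hu R) (hy τ) n
    rw [dist_comm, dist_eq_norm]
    exact hu' R n τ hτ
  refine ⟨y, ?_, fun τ => ?_⟩
  · refine tendsto_nhds_unique (hy 0) ?_
    simp [hY0]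
  · obtain ⟨K, hK⟩ := hl (|τ| + 1)
    have hτmem : τ ∈ Metric.ball (0 : ℝ) (|τ| + 1) := by simp
    -- The derivatives v(τ, Yₙ) converge uniformly on a ball containing τ, by the Lipschitz bound
    -- and the tail estimate, so differentiation passes to the limit.
    refine hasDerivAt_of_tendstoUniformlyOn (l := Filter.atTop) (f := fun n => Y (n + 1))
      (f' := fun n τ => v τ (Y n τ)) (g' := fun τ => v τ (y τ)) Metric.isOpen_ball ?_
      (Filter.Eventually.of_forall fun n x _ => hYd n x)
      (fun x _ => (hy x).comp (Filter.tendsto_add_atTop_nat 1)) hτmem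
    rw [Metric.tendstoUniformlyOn_iff]
    intro ε hε
    have ht : Filter.Tendsto (fun n => |K| * ∑' m, u (|τ| + 1) (n + m)) Filter.atTop (𝓝 0) := by
      have := (tendsto_sum_nat_add (u (|τ| + 1))).const_mul |K|
      simpa [add_comm] using this
    filter_upwards [ht.eventually (gt_mem_nhds hε)] with n hn x hx
    have hx' : |x| ≤ |τ| + 1 := by simpa using (Metric.mem_ball.mp hx).le
    rw [dist_comm, dist_eq_norm]
    refine lt_of_le_of_lt ((hK x hx' _ _).trans ?_) hn
    exact mul_le_mul (le_abs_self K) (htail _ x hx' n) (norm_nonneg _) (abs_nonneg K)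

/-- Differentiability of a solution of `y' = X(x, μ, y)` in the parameter `μ`, with derivative `W`,
if `Y(x, τ) + h W(x)` solves the equation with parameter `τ + h` up to an error `O(h²)`. -/
theorem hasDerivAt_parameter_of_approx {𝕜 : Type*} [RCLike 𝕜] [NormedSpace 𝕜 V]
    [SMulCommClass ℝ 𝕜 V] {X : ℝ → 𝕜 → V → V} {Y : ℝ → 𝕜 → V} {W w : ℝ → V} {τ : 𝕜} {R C K : ℝ}
    (hY : ∀ x μ, HasDerivAt (fun y => Y y μ) (X x μ (Y x μ)) x)
    (hW : ∀ x, HasDerivAt W (w x) x)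
    (hX : ∀ x h, |x| ≤ R → ‖h‖ ≤ 1 → ∀ y y', ‖X x (τ + h) y - X x (τ + h) y'‖ ≤ K * ‖y - y'‖)
    (hC : ∀ x h, |x| ≤ R → ‖h‖ ≤ 1 →
      ‖X x (τ + h) (Y x τ + h • W x) - X x τ (Y x τ) - h • w x‖ ≤ C * ‖h‖ ^ 2)
    (h0 : HasDerivAt (Y 0) (W 0) τ) (x : ℝ) (hx : |x| ≤ R) : HasDerivAt (Y x) (W x) τ := by
  -- K may vanish; enlarging it to a positive constant allows the Grönwall formula that divides by
  -- it.
  set L := |K| + 1 with hL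
  have hLpos : 0 < L := by positivity
  have hKL : K ≤ L := (le_abs_self K).trans (by simp [hL])
  have est : ∀ h : 𝕜, ‖h‖ ≤ 1 → ‖Y x (τ + h) - Y x τ - h • W x‖ ≤
      Real.exp (L * |x|) * ‖Y 0 (τ + h) - Y 0 τ - h • W 0‖ +
        (C / L * (Real.exp (L * |x|) - 1)) * ‖h‖ ^ 2 := by
    intro h hh
    have := norm_le_gronwallBound_abs (R := R) (K := L) (ε := C * ‖h‖ ^ 2)
      (f := fun x => Y x (τ + h) - Y x τ - h • W x)
      (f' := fun x => X x (τ + h) (Y x (τ + h)) - X x τ (Y x τ) - h • w x)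
      (fun x _ => ((hY x _).sub (hY x _)).sub ((hW x).const_smul h)) le_rfl
      (fun x hx => ?_) x hx
    · rw [gronwallBound_of_K_ne_0 hLpos.ne'] at this
      refine this.trans (le_of_eq ?_)
      ring
    · have h1 := hX x h hx hh (Y x (τ + h)) (Y x τ + h • W x)
      have h2 := hC x h hx hh
      have h3 : K * ‖Y x (τ + h) - (Y x τ + h • W x)‖ ≤
          L * ‖Y x (τ + h) - (Y x τ + h • W x)‖ :=
        mul_le_mul_of_nonneg_right hKL (norm_nonneg _)
      rw [← sub_sub] at h3
      rw [← sub_sub] at h1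
      calc _ = ‖(X x (τ + h) (Y x (τ + h)) - X x (τ + h) (Y x τ + h • W x)) +
            (X x (τ + h) (Y x τ + h • W x) - X x τ (Y x τ) - h • w x)‖ := by
            congr 1; abel
        _ ≤ _ := (norm_add_le _ _).trans (add_le_add (h1.trans h3) h2)
  rw [hasDerivAt_iff_isLittleO_nhds_zero] at h0 ⊢
  have hsq : (fun h : 𝕜 => (C / L * (Real.exp (L * |x|) - 1)) * ‖h‖ ^ 2) =o[𝓝 0] fun h => h := by
    refine Asymptotics.IsLittleO.const_mul_left ?_ _
    refine (Asymptotics.isLittleO_norm_right).mp ?_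
    have : (fun h : 𝕜 => ‖h‖ ^ 2) =o[𝓝 0] fun h : 𝕜 => ‖h‖ ^ 1 :=
      (Asymptotics.isLittleO_pow_pow one_lt_two).comp_tendsto (by simpa using tendsto_norm (x := (0 : 𝕜)))
    simpa using this
  have hsum := ((h0.norm_left.const_mul_left (Real.exp (L * |x|))).add hsq)
  refine Asymptotics.IsBigO.trans_isLittleO (Asymptotics.IsBigO.of_bound 1 ?_) hsum
  filter_upwards [Metric.closedBall_mem_nhds (0 : 𝕜) one_pos] with h hh
  rw [one_mul]
  exact (est h (by simpa using hh)).trans (le_abs_self _)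

end ODE

end LoopSG

namespace LoopSG

/-! ### The sine-Gordon equation and its classical Bäcklund transform -/

section SineGordon

variable {q : ℝ → ℝ → ℝ}

theorem contDiff_deriv_fst (hq : ContDiff ℝ ∞ (fun p : ℝ × ℝ => q p.1 p.2)) :
    ContDiff ℝ ∞ (fun p : ℝ × ℝ => deriv (fun y => q y p.2) p.1) := by
  have h1 : ContDiff ℝ ∞ (fun p : ℝ × ℝ => fderiv ℝ (fun p : ℝ × ℝ => q p.1 p.2) p (1, 0)) :=
    (hq.fderiv_right (m := ∞) le_rfl).clm_apply contDiff_const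
  convert h1 using 2 with p
  have h2 := (hq.differentiable (by simp) p).hasFDerivAt
  have h3 : HasDerivAt (fun y : ℝ => (y, p.2)) ((1 : ℝ), (0 : ℝ)) p.1 :=
    (hasDerivAt_id _).prodMk (hasDerivAt_const _ _)
  exact (HasFDerivAt.comp_hasDerivAt (x := p.1) (f := fun y : ℝ => (y, p.2)) h2 h3).deriv

theorem contDiff_deriv_snd (hq : ContDiff ℝ ∞ (fun p : ℝ × ℝ => q p.1 p.2)) :
    ContDiff ℝ ∞ (fun p : ℝ × ℝ => deriv (fun τ => q p.1 τ) p.2) :=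
  (contDiff_deriv_fst (q := fun t x => q x t) (hq.comp (contDiff_snd.prodMk contDiff_fst))).comp
    (contDiff_snd.prodMk contDiff_fst)

theorem hasDerivAt_fst (hq : ContDiff ℝ ∞ (fun p : ℝ × ℝ => q p.1 p.2)) (x t : ℝ) :
    HasDerivAt (fun y => q y t) (deriv (fun y => q y t) x) x :=
  ((hq.comp (contDiff_id.prodMk contDiff_const)).differentiable (by simp) x).hasDerivAt

theorem hasDerivAt_snd (hq : ContDiff ℝ ∞ (fun p : ℝ × ℝ => q p.1 p.2)) (x t : ℝ) :
    HasDerivAt (fun τ => q x τ) (deriv (fun τ => q x τ) t) t :=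
  ((hq.comp (contDiff_const.prodMk contDiff_id)).differentiable (by simp) t).hasDerivAt

theorem IsSineGordon.hasDerivAt_deriv (hq : IsSineGordon q) (x t : ℝ) :
    HasDerivAt (fun τ => deriv (fun y => q y τ) x) (Real.sin (q x t)) t := by
  rw [← hq.eqn x t]
  exact hasDerivAt_snd (q := fun x t => deriv (fun y => q y t) x)
    (contDiff_deriv_fst hq.smooth) x t

theorem abs_sin_add_sub_le (a b : ℝ) :
    |Real.sin (a + b) - Real.sin a - b * Real.cos a| ≤ b ^ 2 := by
  have := norm_le_pow_div_factorial (C := 1) (R := |b|) 1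
    (g := fun b => Real.sin (a + b) - Real.sin a - b * Real.cos a)
    (g' := fun b => Real.cos (a + b) - Real.cos a) (fun b => ?_) (by simp) (fun b _ => ?_) b le_rfl
  · simp only [Real.norm_eq_abs, Nat.reduceAdd, sq_abs] at this
    refine this.trans ?_
    norm_num [Nat.factorial]
    nlinarith [sq_nonneg b]
  · have h1 := ((hasDerivAt_id b).const_add a).sin
    have h2 := (hasDerivAt_id b).mul_const (Real.cos a)
    simpa using (h1.sub_const (Real.sin a)).fun_sub h2
  · simpa using Real.abs_cos_sub_cos_le (a + b) a

/-- The t-derivative of q_x is sin q, bounded by 1 everywhere. -/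
theorem IsSineGordon.abs_deriv_add_sub_le (hq : IsSineGordon q) (x t h : ℝ) :
    |deriv (fun y => q y (t + h)) x - deriv (fun y => q y t) x| ≤ |h| := by
  have := norm_le_pow_div_factorial (C := 1) (R := |h|) 0
    (g := fun h => deriv (fun y => q y (t + h)) x - deriv (fun y => q y t) x)
    (g' := fun h => Real.sin (q x (t + h))) (fun h => ?_) (by simp) (fun h _ => ?_) h le_rfl
  · simpa using this
  · exact ((hq.hasDerivAt_deriv x (t + h)).comp_const_add t h).sub_const _
  · simpa using Real.abs_sin_le_one _

/-- Second order Taylor estimate in `t` for `q_x`, uniform in `x` on compact intervals. -/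
theorem IsSineGordon.exists_taylor_bound (hq : IsSineGordon q) (R t : ℝ) :
    ∃ C, 0 ≤ C ∧ ∀ x h, |x| ≤ R → |h| ≤ 1 →
      |deriv (fun y => q y (t + h)) x - deriv (fun y => q y t) x - h * Real.sin (q x t)|
        ≤ C * h ^ 2 := by
  -- C bounds q_t, hence the Lipschitz constant in t of sin q, which is the t-derivative of q_x. The
  -- window t ± 1 matches |h| ≤ 1.
  obtain ⟨C, hC⟩ := ((isCompact_Icc (a := -R) (b := R)).prod
    (isCompact_Icc (a := t - 1) (b := t + 1))).exists_bound_of_continuousOn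
    (contDiff_deriv_snd hq.smooth).continuous.continuousOn
  have hlip : ∀ x h, |x| ≤ R → |h| ≤ 1 → |q x (t + h) - q x t| ≤ |C| * |h| := by
    intro x h hx hh
    have := norm_le_pow_div_factorial (C := |C|) (R := 1) 0
      (g := fun h => q x (t + h) - q x t)
      (g' := fun h => deriv (fun τ => q x τ) (t + h)) (fun h => ?_) (by simp) (fun h hh => ?_) h hh
    · simpa using this
    · exact ((hasDerivAt_snd hq.smooth x (t + h)).comp_const_add t h).sub_const _
    · have hh' := abs_le.mp hh
      simpa using (hC (x, t + h) ⟨abs_le.mp hx, by constructor <;> linarith⟩).trans (le_abs_self C)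
  refine ⟨|C|, abs_nonneg C, fun x h hx hh => ?_⟩
  have := norm_le_pow_div_factorial (C := |C|) (R := 1) 1
    (g := fun h => deriv (fun y => q y (t + h)) x - deriv (fun y => q y t) x
      - h * Real.sin (q x t))
    (g' := fun h => Real.sin (q x (t + h)) - Real.sin (q x t)) (fun h => ?_) (by simp)
    (fun h hh => ?_) h hh
  · simp only [Real.norm_eq_abs, Nat.reduceAdd, sq_abs] at this
    refine this.trans ?_
    norm_num [Nat.factorial]
    nlinarith [mul_nonneg (abs_nonneg C) (sq_nonneg h)]
  · have h2 := (hasDerivAt_id h).mul_const (Real.sin (q x t))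
    simpa using (((hq.hasDerivAt_deriv x (t + h)).comp_const_add t h).sub_const _).fun_sub h2
  · simpa using (Real.abs_sin_sub_sin_le _ _).trans (hlip x h hx hh)

/-- `f` is the angle `(r + q)/2` attached to a Bäcklund transform `r` of `q`. -/
structure IsBacklundAngle (s : ℝ) (q f : ℝ → ℝ → ℝ) : Prop where
  deriv_x : ∀ x t, HasDerivAt (fun y => f y t)
    (deriv (fun y => q y t) x + 2 * s * Real.sin (f x t)) x
  deriv_t : ∀ x t, HasDerivAt (fun τ => f x τ) (1 / (2 * s) * Real.sin (f x t - q x t)) t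

/-- Existence of the Bäcklund transform, in terms of its angle. -/
theorem IsSineGordon.exists_isBacklundAngle (hq : IsSineGordon q) {s : ℝ} (hs : s ≠ 0) (f₀ : ℝ) :
    ∃ f, IsBacklundAngle s q f ∧ f 0 0 = f₀ := by
  have hqc : Continuous fun p : ℝ × ℝ => q p.1 p.2 := hq.smooth.continuous
  have hqxc := (contDiff_deriv_fst hq.smooth).continuous
  have hq0 : Continuous fun t => q 0 t := hqc.comp (by fun_prop : Continuous fun t : ℝ => ((0 : ℝ), t))
  -- φ is the angle on the axis x = 0; it serves as initial data for the x-equation at each fixed t.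
  obtain ⟨φ, hφ0, hφ⟩ := exists_global_solution
    (v := fun t y => 1 / (2 * s) * Real.sin (y - q 0 t)) (by fun_prop)
    (fun R => ⟨|1 / (2 * s)|, fun τ _ y y' => by
      rw [← mul_sub, norm_mul, Real.norm_eq_abs, Real.norm_eq_abs, Real.norm_eq_abs]
      refine mul_le_mul_of_nonneg_left ((Real.abs_sin_sub_sin_le _ _).trans (le_of_eq ?_))
        (abs_nonneg _)
      congr 1; ring⟩) f₀
  have hlip : ∀ (x t y y' : ℝ), ‖(deriv (fun y => q y t) x + 2 * s * Real.sin y) -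
      (deriv (fun y => q y t) x + 2 * s * Real.sin y')‖ ≤ |2 * s| * ‖y - y'‖ := by
    intro x t y y'
    rw [add_sub_add_left_eq_sub, ← mul_sub, norm_mul, Real.norm_eq_abs, Real.norm_eq_abs,
      Real.norm_eq_abs]
    exact mul_le_mul_of_nonneg_left (Real.abs_sin_sub_sin_le _ _) (abs_nonneg _)
  have hex : ∀ t, ∃ y : ℝ → ℝ, y 0 = φ t ∧
      ∀ x, HasDerivAt y (deriv (fun y => q y t) x + 2 * s * Real.sin (y x)) x := fun t => by
    have hqt : Continuous fun x => deriv (fun y => q y t) x :=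
      hqxc.comp (by fun_prop : Continuous fun x : ℝ => (x, t))
    exact exists_global_solution
      (v := fun x y => deriv (fun y => q y t) x + 2 * s * Real.sin y) (by fun_prop)
      (fun R => ⟨|2 * s|, fun x _ y y' => hlip x t y y'⟩) (φ t)
  choose F hF0 hF using hex
  refine ⟨fun x t => F t x, ⟨fun x t => hF t x, fun x t => ?_⟩, by simp [hF0, hφ0]⟩
  obtain ⟨C, hC0, hC⟩ := hq.exists_taylor_bound |x| t
  -- W is the value f_t must have, and w is its x-derivative, in which q_x cancels.
  refine hasDerivAt_parameter_of_approx (𝕜 := ℝ) (V := ℝ) (R := |x|) (K := |2 * s|)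
    (C := C + |2 * s| * (1 / (2 * s)) ^ 2)
    (X := fun x t y => deriv (fun y => q y t) x + 2 * s * Real.sin y) (Y := fun x t => F t x)
    (W := fun x => 1 / (2 * s) * Real.sin (F t x - q x t))
    (w := fun x => Real.cos (F t x - q x t) * Real.sin (F t x))
    (fun x t => hF t x) (fun x => ?_) (fun x h _ _ y y' => hlip x (t + h) y y')
    (fun x h hx hh => ?_) ?_ x le_rfl
  · have := (((hF t x).fun_sub (hasDerivAt_fst hq.smooth x t)).sin).const_mul (1 / (2 * s))
    refine this.congr_deriv ?_
    field_simp
    ring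
  · set W := 1 / (2 * s) * Real.sin (F t x - q x t) with hW
    have h1 := hC x h hx hh
    have h2 := abs_sin_add_sub_le (F t x) (h * W)
    have hWsq : W ^ 2 ≤ (1 / (2 * s)) ^ 2 := by
      rw [hW, mul_pow]
      nlinarith [Real.sin_sq_le_one (F t x - q x t), sq_nonneg (1 / (2 * s))]
    -- Compatibility: W solves the x-equation linearized at f, that is W_x = sin q + 2sW cos f. This
    -- is where q_xt = sin q is used.
    have hid : Real.sin (q x t) + 2 * s * (W * Real.cos (F t x)) -
        Real.cos (F t x - q x t) * Real.sin (F t x) = 0 := by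
      have : q x t = F t x - (F t x - q x t) := by ring
      rw [hW, this, Real.sin_sub, ← this]
      field_simp
      ring
    have heq : deriv (fun y => q y (t + h)) x + 2 * s * Real.sin (F t x + h • W) -
        (deriv (fun y => q y t) x + 2 * s * Real.sin (F t x)) -
        h • (Real.cos (F t x - q x t) * Real.sin (F t x)) =
        (deriv (fun y => q y (t + h)) x - deriv (fun y => q y t) x - h * Real.sin (q x t)) +
        2 * s * (Real.sin (F t x + h * W) - Real.sin (F t x) - h * W * Real.cos (F t x)) := by
      simp only [smul_eq_mul]
      linear_combination h * hid
    rw [heq]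
    refine (norm_add_le _ _).trans ?_
    rw [norm_mul, Real.norm_eq_abs, Real.norm_eq_abs, Real.norm_eq_abs, Real.norm_eq_abs, sq_abs,
      add_mul, mul_assoc _ _ (h ^ 2)]
    refine add_le_add h1 (mul_le_mul_of_nonneg_left (h2.trans ?_) (abs_nonneg _))
    rw [mul_pow, mul_comm]
    exact mul_le_mul_of_nonneg_right hWsq (sq_nonneg h)
  · simp only [hF0]
    exact hφ t

/-- A function whose partial derivatives are `C^n` whenever it is `C^n` is smooth. -/
theorem contDiff_of_partial_bootstrap {f f₁ f₂ : ℝ → ℝ → ℝ}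
    (hf : Continuous fun p : ℝ × ℝ => f p.1 p.2)
    (h₁ : ∀ x t, HasDerivAt (fun y => f y t) (f₁ x t) x)
    (h₂ : ∀ x t, HasDerivAt (fun τ => f x τ) (f₂ x t) t)
    (hb : ∀ n : ℕ, ContDiff ℝ n (fun p : ℝ × ℝ => f p.1 p.2) →
      ContDiff ℝ n (fun p : ℝ × ℝ => f₁ p.1 p.2) ∧ ContDiff ℝ n (fun p : ℝ × ℝ => f₂ p.1 p.2)) :
    ContDiff ℝ ∞ (fun p : ℝ × ℝ => f p.1 p.2) := by
  have h0 := hb 0 (by exact_mod_cast (contDiff_zero (𝕜 := ℝ)).mpr hf)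
  have hc₁ : Continuous fun p : ℝ × ℝ => f₁ p.1 p.2 := h0.1.continuous
  have hc₂ : Continuous fun p : ℝ × ℝ => f₂ p.1 p.2 := h0.2.continuous
  let D : ℝ → ℝ →L[ℝ] ℝ := fun c => ContinuousLinearMap.toSpanSingleton ℝ c
  have hD : ContDiff ℝ ∞ D :=
    (ContinuousLinearMap.toSpanSingletonCLE (𝕜 := ℝ) (E := ℝ)).contDiff
  have hfd : ∀ p : ℝ × ℝ, HasFDerivAt (fun p : ℝ × ℝ => f p.1 p.2)
      ((D (f₁ p.1 p.2)).coprod (D (f₂ p.1 p.2))) p := by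
    intro p
    exact (hasStrictFDerivAt_uncurry_coprod (𝕜 := ℝ) (f := f) (f₁ := fun x t => D (f₁ x t))
      (f₂ := fun x t => D (f₂ x t)) (u := p)
      (Filter.Eventually.of_forall fun v => (h₁ v.1 v.2).hasFDerivAt)
      (Filter.Eventually.of_forall fun v => (h₂ v.1 v.2).hasFDerivAt)
      (hD.continuous.comp hc₁).continuousAt (hD.continuous.comp hc₂).continuousAt).hasFDerivAt
  rw [contDiff_infty]
  intro n
  induction n with
  | zero => exact_mod_cast (contDiff_zero (𝕜 := ℝ)).mpr hf
  | succ n ih =>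
    have hn := hb n ih
    refine contDiff_succ_iff_hasFDerivAt.mpr
      ⟨fun p => (D (f₁ p.1 p.2)).coprod (D (f₂ p.1 p.2)), ?_, hfd⟩
    have hD' : ContDiff ℝ n D := hD.of_le (by exact_mod_cast le_top)
    refine contDiff_clm_apply_iff.mpr fun v => ?_
    simp only [ContinuousLinearMap.coprod_apply]
    exact ((hD'.comp hn.1).clm_apply contDiff_const).add ((hD'.comp hn.2).clm_apply contDiff_const)

/-- The system expresses both partial derivatives of f through f and smooth functions of q, so
regularity improves by one order at a time. Joint continuity to start from holds because f is
Lipschitz in t with a constant independent of x. -/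
theorem IsBacklundAngle.contDiff {s : ℝ} {f : ℝ → ℝ → ℝ} (hf : IsBacklundAngle s q f)
    (hq : IsSineGordon q) : ContDiff ℝ ∞ (fun p : ℝ × ℝ => f p.1 p.2) := by
  refine contDiff_of_partial_bootstrap ?_ hf.deriv_x hf.deriv_t fun n hn => ?_
  · refine continuous_prod_of_continuous_lipschitzWith' _ (Real.nnabs (1 / (2 * s))) (fun x => ?_)
      (fun t => continuous_iff_continuousAt.mpr fun x => (hf.deriv_x x t).continuousAt)
    refine lipschitzWith_of_nnnorm_deriv_le (fun t => (hf.deriv_t x t).differentiableAt) fun t => ?_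
    rw [(hf.deriv_t x t).deriv, ← NNReal.coe_le_coe, coe_nnnorm, norm_mul, Real.coe_nnabs,
      Real.norm_eq_abs, Real.norm_eq_abs]
    exact mul_le_of_le_one_right (abs_nonneg _) (Real.abs_sin_le_one _)
  · have hle : ((n : ℕ∞) : WithTop ℕ∞) ≤ ∞ := by exact_mod_cast le_top
    have hqn : ContDiff ℝ n (fun p : ℝ × ℝ => q p.1 p.2) := hq.smooth.of_le hle
    have hqx : ContDiff ℝ n (fun p : ℝ × ℝ => deriv (fun y => q y p.2) p.1) :=
      (contDiff_deriv_fst hq.smooth).of_le hle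
    exact ⟨hqx.add (contDiff_const.mul hn.sin), contDiff_const.mul (hn.sub hqn).sin⟩

/-- The Bäcklund system in terms of the angle. -/
theorem isClassicalBacklund_iff (hq : IsSineGordon q) {s c : ℝ} (hs : s ≠ 0) {f : ℝ → ℝ → ℝ} :
    IsClassicalBacklund s c q (fun x t => 2 * f x t - q x t) ↔
      IsBacklundAngle s q f ∧ 2 * f 0 0 - q 0 0 = c := by
  constructor
  · intro h
    refine ⟨⟨fun x t => ?_, fun x t => ?_⟩, h.base⟩
    · have := ((h.deriv_x x t).add ((hasDerivAt_fst hq.smooth x t).const_mul 2)).const_mul (1 / 2)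
      refine (this.congr_deriv ?_).congr_of_eventuallyEq (Filter.Eventually.of_forall fun y => ?_)
      · simp only [sub_add_cancel, mul_div_cancel_left₀ (f x t) (two_ne_zero (α := ℝ))]
        ring
      · simp only [Pi.add_apply]
        ring
    · have := (h.deriv_t x t).const_mul (1 / 2)
      refine (this.congr_deriv ?_).congr_of_eventuallyEq (Filter.Eventually.of_forall fun y => ?_)
      · rw [show (2 * f x t - q x t - q x t) / 2 = f x t - q x t by ring]
        field_simp
      · simp only []
        ring
  · rintro ⟨h, h0⟩
    refine ⟨fun x t => ?_, fun x t => ?_, h0⟩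
    · have := ((h.deriv_x x t).const_mul 2).sub ((hasDerivAt_fst hq.smooth x t).const_mul 2)
      refine (this.congr_deriv ?_).congr_of_eventuallyEq (Filter.Eventually.of_forall fun y => ?_)
      · simp only [sub_add_cancel, mul_div_cancel_left₀ (f x t) (two_ne_zero (α := ℝ))]
        ring
      · simp only [Pi.sub_apply]
        ring
    · have := (h.deriv_t x t).const_mul 2
      refine (this.congr_deriv ?_).congr_of_eventuallyEq (Filter.Eventually.of_forall fun y => ?_)
      · rw [show (2 * f x t - q x t - q x t) / 2 = f x t - q x t by ring]
        field_simp
      · simp only []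
        ring

/-- Two angles agree along x = 0 by the t-equation, then along each horizontal line by the
x-equation; both right sides are Lipschitz in the angle. -/
theorem IsBacklundAngle.unique {s : ℝ} {f f' : ℝ → ℝ → ℝ} (hf : IsBacklundAngle s q f)
    (hf' : IsBacklundAngle s q f') (h0 : f 0 0 = f' 0 0) : f = f' := by
  have ht : ∀ t, f 0 t - f' 0 t = 0 :=
    eq_zero_of_norm_deriv_le (fun t => (hf.deriv_t 0 t).sub (hf'.deriv_t 0 t)) (by simp [h0])
      fun R => ⟨|1 / (2 * s)|, fun t _ => by
        rw [← mul_sub, norm_mul, Real.norm_eq_abs, Real.norm_eq_abs, Real.norm_eq_abs]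
        refine mul_le_mul_of_nonneg_left ((Real.abs_sin_sub_sin_le _ _).trans (le_of_eq ?_))
          (abs_nonneg _)
        congr 1
        simp⟩
  funext x t
  refine sub_eq_zero.mp (eq_zero_of_norm_deriv_le
    (fun x => (hf.deriv_x x t).sub (hf'.deriv_x x t)) (ht t)
    (fun R => ⟨|2 * s|, fun x _ => ?_⟩) x)
  rw [add_sub_add_left_eq_sub, ← mul_sub, norm_mul, Real.norm_eq_abs, Real.norm_eq_abs,
    Real.norm_eq_abs]
  exact mul_le_mul_of_nonneg_left (Real.abs_sin_sub_sin_le _ _) (abs_nonneg _)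

theorem IsBacklundAngle.deriv_transform {s : ℝ} {f : ℝ → ℝ → ℝ} (hf : IsBacklundAngle s q f)
    (hq : IsSineGordon q) (x t : ℝ) : deriv (fun y => 2 * f y t - q y t) x =
      deriv (fun y => q y t) x + 4 * s * Real.sin (f x t) := by
  rw [(((hf.deriv_x x t).const_mul 2).fun_sub (hasDerivAt_fst hq.smooth x t)).deriv]
  ring

/-- The Bäcklund transform of a sine-Gordon solution is a sine-Gordon solution. -/
theorem IsBacklundAngle.isSineGordon {s : ℝ} (hs : s ≠ 0) {f : ℝ → ℝ → ℝ}
    (hf : IsBacklundAngle s q f) (hq : IsSineGordon q) :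
    IsSineGordon (fun x t => 2 * f x t - q x t) := by
  refine ⟨(contDiff_const.mul (hf.contDiff hq)).sub hq.smooth, fun x t => ?_⟩
  simp only [hf.deriv_transform hq]
  have h1 := (hq.hasDerivAt_deriv x t).add ((hf.deriv_t x t).sin.const_mul (4 * s))
  refine h1.deriv.trans ?_
  -- With d = f - q the claim becomes sin(f - d) + 2 cos f sin d = sin(f + d).
  have e1 : q x t = f x t - (f x t - q x t) := by ring
  have e2 : 2 * f x t - q x t = f x t + (f x t - q x t) := by ring
  rw [e2, Real.sin_add]
  nth_rw 1 [e1]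
  rw [Real.sin_sub]
  field_simp
  ring

end SineGordon

end LoopSG

namespace LoopSG

/-! ### Entrywise calculus of matrix functions and linear equations -/

section MatrixCalculus

attribute [local instance] Matrix.normedAddCommGroup Matrix.normedSpace

variable {n : Type*} {F G : ℝ → Matrix n n ℂ} {F' G' : Matrix n n ℂ} {x : ℝ}

theorem hasMatDerivAt_iff [Fintype n] : HasMatDerivAt F F' x ↔ HasDerivAt F F' x :=
  (hasDerivAt_pi.trans (forall_congr' fun _ => hasDerivAt_pi)).symm

theorem HasMatDerivAt.congr_deriv (hF : HasMatDerivAt F F' x) (h : F' = G') :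
    HasMatDerivAt F G' x := h ▸ hF

theorem HasMatDerivAt.unique (hF : HasMatDerivAt F F' x) (hG : HasMatDerivAt F G' x) : F' = G' :=
  Matrix.ext fun i j => (hF i j).unique (hG i j)

theorem hasMatDerivAt_const (A : Matrix n n ℂ) (x : ℝ) : HasMatDerivAt (fun _ => A) 0 x :=
  fun _ _ => hasDerivAt_const _ _

theorem HasMatDerivAt.mul [Fintype n] (hF : HasMatDerivAt F F' x) (hG : HasMatDerivAt G G' x) :
    HasMatDerivAt (fun y => F y * G y) (F' * G x + F x * G') x := by
  intro i j
  simp only [Matrix.mul_apply, Matrix.add_apply, ← Finset.sum_add_distrib]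
  exact HasDerivAt.fun_sum fun k _ => (hF i k).mul (hG k j)

theorem HasMatDerivAt.const_smul (hF : HasMatDerivAt F F' x) (c : ℂ) :
    HasMatDerivAt (fun y => c • F y) (c • F') x :=
  fun i j => (hF i j).const_mul c

theorem HasMatDerivAt.add (hF : HasMatDerivAt F F' x) (hG : HasMatDerivAt G G' x) :
    HasMatDerivAt (fun y => F y + G y) (F' + G') x :=
  fun i j => (hF i j).add (hG i j)

theorem HasMatDerivAt.sub (hF : HasMatDerivAt F F' x) (hG : HasMatDerivAt G G' x) :
    HasMatDerivAt (fun y => F y - G y) (F' - G') x :=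
  fun i j => (hF i j).sub (hG i j)

theorem HasMatDerivAt.conjTranspose (hF : HasMatDerivAt F F' x) :
    HasMatDerivAt (fun y => (F y).conjTranspose) F'.conjTranspose x :=
  fun i j => (hF j i).star

theorem eq_of_hasMatDerivAt_zero {F : ℝ → ℝ → Matrix n n ℂ}
    (hx : ∀ x t, HasMatDerivAt (fun y => F y t) 0 x)
    (ht : ∀ x t, HasMatDerivAt (fun τ => F x τ) 0 t) (x t : ℝ) : F x t = F 0 0 := by
  have key : ∀ f : ℝ → ℂ, (∀ y, HasDerivAt f 0 y) → ∀ y, f y = f 0 := fun f hf y =>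
    is_const_of_deriv_eq_zero (fun y => (hf y).differentiableAt) (fun y => (hf y).deriv) y 0
  ext i j
  rw [key (fun y => F y t i j) (fun y => hx y t i j) x,
    key (fun τ => F 0 τ i j) (fun τ => ht 0 τ i j) t]

theorem norm_matrix_mul_le [Fintype n] (A B : Matrix n n ℂ) :
    ‖A * B‖ ≤ Fintype.card n * (‖A‖ * ‖B‖) := by
  refine (Matrix.norm_le_iff (by positivity)).mpr fun i j => ?_
  rw [Matrix.mul_apply]
  refine (norm_sum_le _ _).trans ((Finset.sum_le_card_nsmul _ _ (‖A‖ * ‖B‖) fun k _ => ?_).trans ?_)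
  · rw [norm_mul]
    exact mul_le_mul (A.norm_entry_le_entrywise_sup_norm) (B.norm_entry_le_entrywise_sup_norm)
      (norm_nonneg _) (norm_nonneg _)
  · simp [Finset.card_univ]

theorem exists_bound_abs_le [Fintype n] {f : ℝ → Matrix n n ℂ} (hf : Continuous f) (R : ℝ) :
    ∃ C, 0 ≤ C ∧ ∀ x, |x| ≤ R → ‖f x‖ ≤ C := by
  obtain ⟨C, hC⟩ := (isCompact_Icc (a := -R) (b := R)).exists_bound_of_continuousOn hf.continuousOn
  exact ⟨|C|, abs_nonneg C, fun x hx => (hC x (abs_le.mp hx)).trans (le_abs_self C)⟩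

/-- Existence of a solution of `y' = y A + B` for continuous `A` and `B`. -/
theorem exists_linear_solution [Fintype n] {A B : ℝ → Matrix n n ℂ} (hA : Continuous A) (hB : Continuous B)
    (y₀ : Matrix n n ℂ) :
    ∃ y : ℝ → Matrix n n ℂ, y 0 = y₀ ∧ ∀ τ, HasDerivAt y (y τ * A τ + B τ) τ := by
  refine exists_global_solution (v := fun τ y => y * A τ + B τ) ?_ (fun R => ?_) y₀
  · exact (continuous_snd.matrix_mul (hA.comp continuous_fst)).add (hB.comp continuous_fst)
  · obtain ⟨C, hC0, hC⟩ := exists_bound_abs_le hA R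
    refine ⟨Fintype.card n * C, fun τ hτ y y' => ?_⟩
    rw [add_sub_add_right_eq_sub, ← sub_mul]
    refine (norm_matrix_mul_le _ _).trans ?_
    rw [mul_assoc, mul_comm C]
    gcongr
    exact hC τ hτ

/-- The fundamental solution of `y' = y (A₀ + μ A₁)` exists and is an entire function of `μ`. -/
theorem exists_fundamental_solution [Fintype n] [DecidableEq n] {A₀ A₁ : ℝ → Matrix n n ℂ}
    (h₀ : Continuous A₀) (h₁ : Continuous A₁) :
    ∃ Φ : ℝ → ℂ → Matrix n n ℂ, (∀ μ, Φ 0 μ = 1) ∧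
      (∀ τ μ, HasMatDerivAt (fun y => Φ y μ) (Φ τ μ * (A₀ τ + μ • A₁ τ)) τ) ∧
      ∀ τ i j, Differentiable ℂ (fun μ => Φ τ μ i j) := by
  have hA : ∀ μ : ℂ, Continuous fun τ => A₀ τ + μ • A₁ τ := fun μ => h₀.add (h₁.const_smul μ)
  choose Φ hΦ0 hΦ using fun μ : ℂ => exists_linear_solution (hA μ) (continuous_const (y := 0)) 1
  simp only [add_zero] at hΦ
  refine ⟨fun τ μ => Φ μ τ, hΦ0, fun τ μ => hasMatDerivAt_iff.mpr (hΦ μ τ), ?_⟩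
  have hΦc : ∀ μ, Continuous (Φ μ) := fun μ =>
    continuous_iff_continuousAt.mpr fun τ => (hΦ μ τ).continuousAt
  intro τ i j μ
  -- D is the candidate for the derivative of Φ in μ: it solves the variational equation D' = D(A₀ +
  -- μA₁) + ΦA₁ with D(0) = 0.
  obtain ⟨D, hD0, hD⟩ := exists_linear_solution (hA μ) ((hΦc μ).matrix_mul h₁) 0
  have hDc : Continuous D := continuous_iff_continuousAt.mpr fun τ => (hD τ).continuousAt
  obtain ⟨C, hC0, hC⟩ := exists_bound_abs_le (hA μ) |τ|
  obtain ⟨C₁, hC₁0, hC₁⟩ := exists_bound_abs_le h₁ |τ|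
  obtain ⟨C₂, hC₂0, hC₂⟩ := exists_bound_abs_le (hDc.matrix_mul h₁) |τ|
  have := hasDerivAt_parameter_of_approx (𝕜 := ℂ) (V := Matrix n n ℂ) (R := |τ|)
    (K := Fintype.card n * (C + C₁)) (C := C₂) (τ := μ) (Y := fun τ μ => Φ μ τ)
    (X := fun τ μ y => y * (A₀ τ + μ • A₁ τ)) (W := D) (fun τ μ => hΦ μ τ) hD
    (fun x h hx hh y y' => ?_) (fun x h hx hh => ?_) ?_ τ le_rfl
  · have h2 := hasDerivAt_pi.mp (hasDerivAt_pi.mp this i) j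
    exact h2.differentiableAt
  · rw [← sub_mul]
    refine (norm_matrix_mul_le _ _).trans ?_
    rw [mul_assoc, mul_comm ‖y - y'‖]
    gcongr
    rw [add_smul, ← add_assoc]
    refine (norm_add_le _ _).trans (add_le_add (hC x hx) ?_)
    rw [norm_smul]
    exact (mul_le_of_le_one_left (norm_nonneg _) hh).trans (hC₁ x hx)
  · have : (Φ μ x + h • D x) * (A₀ x + (μ + h) • A₁ x) - Φ μ x * (A₀ x + μ • A₁ x) -
        h • (D x * (A₀ x + μ • A₁ x) + Φ μ x * A₁ x) = h ^ 2 • (D x * A₁ x) := by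
      simp only [mul_add, add_mul, smul_mul_assoc, mul_smul_comm, smul_add, add_smul, smul_smul,
        pow_two, mul_comm μ h]
      abel
    simp only [this, norm_smul, norm_pow]
    rw [mul_comm]
    gcongr
    exact hC₂ x hx
  · simp only [hΦ0, hD0]
    exact hasDerivAt_const _ _

end MatrixCalculus

/-! ### The Lax pair of a sine-Gordon solution and its trivialization -/

section LaxPair

variable {q : ℝ → ℝ → ℝ}

/-- The reflection matrix `[[cos θ, sin θ], [sin θ, -cos θ]]`. -/
noncomputable def reflMatrix (θ : ℝ) : Matrix (Fin 2) (Fin 2) ℂ :=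
  !![((Real.cos θ : ℝ) : ℂ), ((Real.sin θ : ℝ) : ℂ);
     ((Real.sin θ : ℝ) : ℂ), -((Real.cos θ : ℝ) : ℂ)]

/-- The derivative of `reflMatrix` in the angle. -/
noncomputable def reflMatrixDeriv (θ : ℝ) : Matrix (Fin 2) (Fin 2) ℂ :=
  !![-((Real.sin θ : ℝ) : ℂ), ((Real.cos θ : ℝ) : ℂ);
     ((Real.cos θ : ℝ) : ℂ), ((Real.sin θ : ℝ) : ℂ)]

theorem hasMatDerivAt_smul_reflMatrix {θ : ℝ → ℝ} {θ' x : ℝ} (h : HasDerivAt θ θ' x) (c : ℂ) :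
    HasMatDerivAt (fun y => c • reflMatrix (θ y)) ((c * θ') • reflMatrixDeriv (θ x)) x := by
  have hc := (h.cos.ofReal_comp).const_mul c
  have hs := (h.sin.ofReal_comp).const_mul c
  intro i j
  fin_cases i <;> fin_cases j <;>
    simp only [reflMatrix, reflMatrixDeriv, Matrix.smul_apply, Matrix.of_apply, Matrix.cons_val',
      Matrix.cons_val_zero, Matrix.cons_val_one, Matrix.cons_val_fin_one, smul_eq_mul,
      Fin.zero_eta, Fin.mk_one, mul_neg]
  · exact hc.congr_deriv (by push_cast; ring)
  · exact hs.congr_deriv (by push_cast; ring)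
  · exact hs.congr_deriv (by push_cast; ring)
  · exact hc.neg.congr_deriv (by push_cast; ring)

theorem angleProj_eq (f : ℝ) : angleProj f = (1 / 2 : ℂ) • (1 + reflMatrix f) := by
  have hc : Real.cos f = 2 * Real.cos (f / 2) ^ 2 - 1 := by
    rw [← Real.cos_two_mul]; congr 1; ring
  have hs : Real.sin f = 2 * Real.sin (f / 2) * Real.cos (f / 2) := by
    rw [← Real.sin_two_mul]; congr 1; ring
  have h1 : Real.sin (f / 2) ^ 2 = 1 - Real.cos (f / 2) ^ 2 := by
    rw [← Real.sin_sq_add_cos_sq (f / 2)]; ring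
  ext i j
  fin_cases i <;> fin_cases j <;>
    simp [angleProj, reflMatrix, hc, hs, h1, -Complex.ofReal_cos, -Complex.ofReal_sin] <;> ring

/-- The matrix `g⁻¹ b g` for the frame `g = exp ((q/2) J)`. -/
noncomputable def sgQ (θ : ℝ) : Matrix (Fin 2) (Fin 2) ℂ := (-(Complex.I / 4)) • reflMatrix θ

theorem sgFrame_mul_transpose (q : ℝ → ℝ → ℝ) (x t : ℝ) :
    (sgFrame q x t).transpose * sgFrame q x t = 1 := by
  have h := Real.sin_sq_add_cos_sq (q x t / 2)
  have h' : ((Real.sin (q x t / 2) : ℝ) : ℂ) ^ 2 + ((Real.cos (q x t / 2) : ℝ) : ℂ) ^ 2 = 1 := by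
    exact_mod_cast h
  ext i j
  fin_cases i <;> fin_cases j <;>
    simp [sgFrame, Matrix.mul_apply, Fin.sum_univ_two, -Complex.ofReal_cos, -Complex.ofReal_sin] <;>
    first | ring_nf; done | linear_combination h'

theorem sgFrame_inv (q : ℝ → ℝ → ℝ) (x t : ℝ) :
    (sgFrame q x t)⁻¹ = (sgFrame q x t).transpose :=
  Matrix.inv_eq_left_inv (sgFrame_mul_transpose q x t)

theorem sgFrame_conj (q : ℝ → ℝ → ℝ) (x t : ℝ) :
    (sgFrame q x t)⁻¹ * sgB * sgFrame q x t = sgQ (q x t) := by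
  have hc : Real.cos (q x t) = Real.cos (q x t / 2) ^ 2 - Real.sin (q x t / 2) ^ 2 := by
    rw [← Real.cos_two_mul']; congr 1; ring
  have hs : Real.sin (q x t) = 2 * Real.sin (q x t / 2) * Real.cos (q x t / 2) := by
    rw [← Real.sin_two_mul]; congr 1; ring
  rw [sgFrame_inv]
  ext i j
  fin_cases i <;> fin_cases j <;>
    simp [sgFrame, sgB, sgA, sgQ, reflMatrix, Matrix.mul_apply, Fin.sum_univ_two, hc, hs,
      -Complex.ofReal_cos, -Complex.ofReal_sin] <;> ring

/-- The matrix `[[0, 1], [-1, 0]]`. -/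
def sgJ : Matrix (Fin 2) (Fin 2) ℂ := !![0, 1; -1, 0]

theorem sgPotential_eq (q : ℝ → ℝ → ℝ) (x t : ℝ) :
    sgPotential q x t = (((deriv (fun y => q y t) x / 2 : ℝ) : ℂ)) • sgJ := by
  ext i j
  fin_cases i <;> fin_cases j <;> simp [sgPotential, sgJ]

theorem sgA_conjTranspose : sgA.conjTranspose = -sgA := by
  ext i j
  fin_cases i <;> fin_cases j <;> simp [sgA, Matrix.conjTranspose_apply]

theorem sgPotential_conjTranspose (q : ℝ → ℝ → ℝ) (x t : ℝ) :
    (sgPotential q x t).conjTranspose = -sgPotential q x t := by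
  ext i j
  fin_cases i <;> fin_cases j <;> simp [sgPotential, Matrix.conjTranspose_apply]

theorem sgQ_conjTranspose (θ : ℝ) : (sgQ θ).conjTranspose = -sgQ θ := by
  ext i j
  fin_cases i <;> fin_cases j <;>
    simp [sgQ, reflMatrix, Matrix.conjTranspose_apply, -Complex.ofReal_cos, -Complex.ofReal_sin] <;>
    ring

/-- With u = (q_x/2)J, this makes u_t = [a, g⁻¹bg] the sine-Gordon equation. -/
theorem sgA_commutator_sgQ (θ : ℝ) :
    sgA * sgQ θ - sgQ θ * sgA = ((Real.sin θ / 2 : ℝ) : ℂ) • sgJ := by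
  ext i j
  fin_cases i <;> fin_cases j <;>
    simp [sgQ, reflMatrix, sgA, sgJ, -Complex.ofReal_cos,
      -Complex.ofReal_sin] <;> ring_nf <;> simp <;> ring

/-- This is Q_x = [Q, u] for Q = g⁻¹bg; together with u_t = [a, Q] it is the zero-curvature
condition of the Lax pair. -/
theorem hasMatDerivAt_sgQ (hq : IsSineGordon q) (x t : ℝ) :
    HasMatDerivAt (fun y => sgQ (q y t))
      (sgQ (q x t) * sgPotential q x t - sgPotential q x t * sgQ (q x t)) x := by
  refine (hasMatDerivAt_smul_reflMatrix (hasDerivAt_fst hq.smooth x t) _).congr_deriv ?_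
  rw [sgPotential_eq]
  ext i j
  fin_cases i <;> fin_cases j <;>
    simp [sgQ, reflMatrix, reflMatrixDeriv, sgJ,
      -Complex.ofReal_cos, -Complex.ofReal_sin] <;> ring

/-- The trivialization of the Lax pair of a sine-Gordon solution. -/
structure IsLaxFrame (q : ℝ → ℝ → ℝ) (E : ℝ → ℝ → ℂ → Matrix (Fin 2) (Fin 2) ℂ) : Prop where
  base : ∀ l, l ≠ 0 → E 0 0 l = 1
  deriv_x : ∀ x t l, l ≠ 0 →
    HasMatDerivAt (fun y => E y t l) (E x t l * (l • sgA + sgPotential q x t)) x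
  deriv_t : ∀ x t l, l ≠ 0 → HasMatDerivAt (fun τ => E x τ l) (E x t l * (l⁻¹ • sgQ (q x t))) t

/-- The coefficient matrices at l and at conj l are negative adjoints of each other, so the product
has zero derivative in x and t. It also serves to invert E without computing an inverse. -/
theorem IsLaxFrame.mul_conjTranspose {E : ℝ → ℝ → ℂ → Matrix (Fin 2) (Fin 2) ℂ}
    (hE : IsLaxFrame q E) (x t : ℝ) {l : ℂ} (hl : l ≠ 0) :
    E x t l * (E x t (star l)).conjTranspose = 1 := by
  have hl' : star l ≠ 0 := star_ne_zero.mpr hl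
  rw [eq_of_hasMatDerivAt_zero (F := fun x t => E x t l * (E x t (star l)).conjTranspose)
    (fun x t => ?_) (fun x t => ?_) x t]
  · simp only [hE.base l hl, hE.base _ hl', Matrix.conjTranspose_one, mul_one]
  · refine ((hE.deriv_x x t l hl).mul (hE.deriv_x x t _ hl').conjTranspose).congr_deriv ?_
    rw [Matrix.conjTranspose_mul, Matrix.conjTranspose_add, Matrix.conjTranspose_smul, star_star,
      sgA_conjTranspose, sgPotential_conjTranspose]
    simp only [mul_add, add_mul, mul_neg, neg_mul, smul_neg, smul_mul_assoc, mul_smul_comm, mul_assoc]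
    abel
  · refine ((hE.deriv_t x t l hl).mul (hE.deriv_t x t _ hl').conjTranspose).congr_deriv ?_
    rw [Matrix.conjTranspose_mul, Matrix.conjTranspose_smul, sgQ_conjTranspose, star_inv₀,
      star_star]
    simp [mul_assoc]

theorem IsLaxFrame.conjTranspose_mul {E : ℝ → ℝ → ℂ → Matrix (Fin 2) (Fin 2) ℂ}
    (hE : IsLaxFrame q E) (x t : ℝ) {l : ℂ} (hl : l ≠ 0) :
    (E x t (star l)).conjTranspose * E x t l = 1 :=
  mul_eq_one_comm.mp (hE.mul_conjTranspose x t hl)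

theorem continuous_sgQ : Continuous sgQ := by
  refine (continuous_matrix fun i j => ?_ : Continuous reflMatrix).const_smul (-(Complex.I / 4))
  fin_cases i <;> fin_cases j <;> simp [reflMatrix] <;> fun_prop

theorem IsSineGordon.continuous_sgPotential (hq : IsSineGordon q) (t : ℝ) :
    Continuous fun x => sgPotential q x t := by
  simp only [sgPotential_eq]
  have : Continuous fun x => deriv (fun y => q y t) x :=
    (contDiff_deriv_fst hq.smooth).continuous.comp (by fun_prop : Continuous fun x : ℝ => (x, t))
  exact (Complex.continuous_ofReal.comp (this.div_const 2)).smul continuous_const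

section

attribute [local instance] Matrix.normedAddCommGroup Matrix.normedSpace

/-- The Lax pair of a sine-Gordon solution has a trivialization, and it is holomorphic in the
spectral parameter. -/
theorem IsSineGordon.exists_isLaxFrame (hq : IsSineGordon q) :
    ∃ E, IsLaxFrame q E ∧ ∀ x t i j, DifferentiableOn ℂ (fun l => E x t l i j) {0}ᶜ := by
  have hqc : Continuous fun p : ℝ × ℝ => q p.1 p.2 := hq.smooth.continuous
  have hQc := continuous_sgQ
  have hQ0 : Continuous fun t => sgQ (q 0 t) :=
    hQc.comp (hqc.comp (by fun_prop : Continuous fun t : ℝ => ((0 : ℝ), t)))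
  have hu := hq.continuous_sgPotential
  -- G transports in t along x = 0 with spectral variable l⁻¹, H transports in x with variable l;
  -- the trivialization is their product, and both factors are entire in their own variable.
  obtain ⟨G, hG0, hG, hGd⟩ := exists_fundamental_solution (A₀ := fun _ => 0) continuous_const hQ0
  choose H hH0 hH hHd using fun t : ℝ =>
    exists_fundamental_solution (hu t) (continuous_const (y := sgA))
  have hx : ∀ x t l, HasMatDerivAt (fun y => G t l⁻¹ * H t y l)
      (G t l⁻¹ * H t x l * (l • sgA + sgPotential q x t)) x := fun x t l =>
    ((hasMatDerivAt_const (G t l⁻¹) x).mul (hH t x l)).congr_deriv (by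
      rw [zero_mul, zero_add, mul_assoc, add_comm (l • sgA)])
  refine ⟨fun x t l => G t l⁻¹ * H t x l, ⟨fun l hl => by simp [hG0, hH0], fun x t l _ => hx x t l,
    fun x t l hl => ?_⟩, fun x t i j => ?_⟩
  · have hEc : Continuous fun x => G t l⁻¹ * H t x l := continuous_iff_continuousAt.mpr fun x =>
      (hasMatDerivAt_iff.mp (hx x t l)).continuousAt
    have hQx : Continuous fun x => l⁻¹ • sgQ (q x t) :=
      (hQc.comp (hqc.comp (by fun_prop : Continuous fun x : ℝ => (x, t)))).fun_const_smul _
    obtain ⟨C, hC0, hC⟩ := hq.exists_taylor_bound |x| t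
    obtain ⟨CA, hCA0, hCA⟩ := exists_bound_abs_le ((hu t).const_add (l • sgA)) |x|
    obtain ⟨CE, hCE0, hCE⟩ := exists_bound_abs_le hEc |x|
    obtain ⟨CQ, hCQ0, hCQ⟩ := exists_bound_abs_le hQx |x|
    have hJ : ‖sgJ‖ ≤ 1 := (Matrix.norm_le_iff zero_le_one).mpr fun i j => by
      fin_cases i <;> fin_cases j <;> simp [sgJ]
    have hdu : ∀ x h, ‖sgPotential q x (t + h) - sgPotential q x t‖ ≤ |h| := fun x h => by
      rw [sgPotential_eq, sgPotential_eq, ← sub_smul, norm_smul, ← Complex.ofReal_sub,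
        Complex.norm_real, Real.norm_eq_abs, ← sub_div, abs_div, abs_two]
      have := hq.abs_deriv_add_sub_le x t h
      refine (mul_le_of_le_one_right (by positivity) hJ).trans ?_
      linarith [abs_nonneg h]
    -- W = l⁻¹EQ is the required t-derivative; w is W_x simplified with Q_x = [Q, u].
    have := hasDerivAt_parameter_of_approx (𝕜 := ℝ) (V := Matrix (Fin 2) (Fin 2) ℂ) (R := |x|)
      (K := 2 * (CA + 1)) (C := 2 * (CE * (C + 2 * CQ)))
      (X := fun x t y => y * (l • sgA + sgPotential q x t)) (Y := fun x t => G t l⁻¹ * H t x l)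
      (W := fun x => G t l⁻¹ * H t x l * (l⁻¹ • sgQ (q x t)))
      (w := fun x => G t l⁻¹ * H t x l * (sgA * sgQ (q x t) +
        l⁻¹ • (sgQ (q x t) * sgPotential q x t))) (τ := t)
      (fun x t => hasMatDerivAt_iff.mp (hx x t l)) (fun x => ?_) (fun x h hx hh y y' => ?_)
      (fun x h hx hh => ?_) ?_ x le_rfl
    · exact hasMatDerivAt_iff.mpr this
    · refine hasMatDerivAt_iff.mp (((hx x t l).mul
        ((hasMatDerivAt_sgQ hq x t).const_smul l⁻¹)).congr_deriv ?_)
      simp only [mul_add, add_mul, mul_sub, smul_add, smul_sub, smul_mul_assoc, mul_smul_comm,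
        mul_assoc, inv_smul_smul₀ hl]
      abel
    · rw [← sub_mul]
      refine (norm_matrix_mul_le _ _).trans ?_
      rw [Fintype.card_fin, mul_comm ‖y - y'‖, ← mul_assoc]
      push_cast
      gcongr
      calc ‖l • sgA + sgPotential q x (t + h)‖
          = ‖(l • sgA + sgPotential q x t) + (sgPotential q x (t + h) - sgPotential q x t)‖ := by
            congr 1; abel
        _ ≤ _ := (norm_add_le _ _).trans (add_le_add (hCA x hx) ((hdu x h).trans hh))
    · set E := G t l⁻¹ * H t x l
      set Q := sgQ (q x t) with hQdef
      set u := sgPotential q x t with hudef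
      set u' := sgPotential q x (t + h) with hu'def
      -- The defect splits into two quadratic terms: u' - u - h[a, Q] is a Taylor remainder since
      -- u_t = [a, Q], and u' - u in the other carries a second factor h.
      have halg : (E + h • (E * (l⁻¹ • Q))) * (l • sgA + u') - E * (l • sgA + u) -
          h • (E * (sgA * Q + l⁻¹ • (Q * u))) =
          E * ((u' - u - (h : ℂ) • (sgA * Q - Q * sgA)) + (h : ℂ) • ((l⁻¹ • Q) * (u' - u))) := by
        simp only [← Complex.coe_smul, mul_add, add_mul, mul_sub, smul_add, smul_sub,
          smul_mul_assoc, mul_smul_comm, mul_assoc, smul_smul]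
        match_scalars <;> field_simp
        ring
      have h1 : ‖u' - u - (h : ℂ) • (sgA * Q - Q * sgA)‖ ≤ C * |h| ^ 2 := by
        rw [hQdef, hudef, hu'def, sgA_commutator_sgQ, sgPotential_eq, sgPotential_eq, smul_smul,
          ← sub_smul, ← sub_smul, ← Complex.ofReal_sub, ← Complex.ofReal_mul, ← Complex.ofReal_sub,
          norm_smul, Complex.norm_real, Real.norm_eq_abs, sq_abs]
        refine (mul_le_of_le_one_right (abs_nonneg _) hJ).trans ?_
        have := hC x h hx hh
        rw [show deriv (fun y => q y (t + h)) x / 2 - deriv (fun y => q y t) x / 2 -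
          h * (Real.sin (q x t) / 2) = (deriv (fun y => q y (t + h)) x -
            deriv (fun y => q y t) x - h * Real.sin (q x t)) / 2 by ring, abs_div, abs_two]
        linarith [abs_nonneg (deriv (fun y => q y (t + h)) x -
            deriv (fun y => q y t) x - h * Real.sin (q x t))]
      have h2 : ‖(h : ℂ) • ((l⁻¹ • Q) * (u' - u))‖ ≤ 2 * CQ * |h| ^ 2 := by
        rw [norm_smul, Complex.norm_real, Real.norm_eq_abs]
        calc |h| * ‖(l⁻¹ • Q) * (u' - u)‖ ≤ |h| * (2 * (CQ * |h|)) := by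
              refine mul_le_mul_of_nonneg_left ((norm_matrix_mul_le _ _).trans ?_) (abs_nonneg h)
              rw [Fintype.card_fin]
              push_cast
              gcongr
              · exact hCQ x hx
              · exact hdu x h
          _ = _ := by ring
      simp only [halg, Real.norm_eq_abs]
      refine (norm_matrix_mul_le _ _).trans ?_
      rw [Fintype.card_fin]
      push_cast
      calc 2 * (‖E‖ * ‖_‖) ≤ 2 * (CE * (C * |h| ^ 2 + 2 * CQ * |h| ^ 2)) := by
            gcongr
            · exact hCE x hx
            · exact (norm_add_le _ _).trans (add_le_add h1 h2)
        _ = _ := by ring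
    · simp only [hH0, mul_one]
      exact hasMatDerivAt_iff.mp ((hG t l⁻¹).congr_deriv (by rw [zero_add]))
  · simp only [Matrix.mul_apply]
    refine DifferentiableOn.fun_sum fun k _ => DifferentiableOn.mul ?_
      (hHd t x k j).differentiableOn
    exact (hGd t i k).comp_differentiableOn (differentiableOn_inv)

end

end LaxPair

end LoopSG

namespace LoopSG

/-! ### Simple elements as rational loops -/

section SimpleElement

theorem IsHermitianProjectionOnto.isRationalLoop_simpleElement {n : Type*} [Fintype n]
    [DecidableEq n] {P : Matrix n n ℂ} {V : Submodule ℂ (n → ℂ)}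
    (hP : IsHermitianProjectionOnto P V) (z : ℂ) : IsRationalLoop (simpleElement z P) := by
  refine ⟨⟨Polynomial.X - Polynomial.C (star z),
    Matrix.of fun i j => (Polynomial.X - Polynomial.C (star z)) * Polynomial.C (P i j) +
      (Polynomial.X - Polynomial.C z) * Polynomial.C ((1 - P) i j),
    Polynomial.X_sub_C_ne_zero _, fun l hl i j => ?_⟩, ?_, ?_⟩
  · have hl' : l - star z ≠ 0 := by simpa using hl
    simp only [simpleElement, Matrix.of_apply, Matrix.add_apply, Matrix.smul_apply, smul_eq_mul,
      Polynomial.eval_add, Polynomial.eval_mul, Polynomial.eval_sub, Polynomial.eval_X,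
      Polynomial.eval_C]
    field_simp
  · have h1 : Filter.Tendsto (fun l : ℂ => 1 + (star z - z) * (l - star z)⁻¹)
        (Filter.cocompact ℂ) (𝓝 1) := by
      rw [← Metric.cobounded_eq_cocompact]
      have h2 : Filter.Tendsto (fun l : ℂ => l - star z) (Bornology.cobounded ℂ)
          (Bornology.cobounded ℂ) := by
        simp [sub_eq_add_neg]
      have h3 := (Filter.tendsto_inv₀_cobounded.comp h2).const_mul (star z - z)
      simpa using h3.const_add 1
    have h2 : Filter.Tendsto (fun l : ℂ => (l - z) / (l - star z)) (Filter.cocompact ℂ) (𝓝 1) := by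
      refine h1.congr' ?_
      have : ∀ᶠ l in Filter.cocompact ℂ, l ≠ star z :=
        Filter.cocompact_le_cofinite (Set.finite_singleton (star z)).compl_mem_cofinite
      filter_upwards [this] with l hl
      have : l - star z ≠ 0 := sub_ne_zero.mpr hl
      field_simp
      ring
    have h3 := (h2.smul_const (1 - P)).const_add P
    rwa [one_smul, add_sub_cancel] at h3
  · have : ∀ᶠ l in Filter.cofinite, l ∉ ({z, star z} : Set ℂ) :=
      (Set.toFinite {z, star z}).compl_mem_cofinite
    filter_upwards [this] with l hl
    simp only [Set.mem_insert_iff, Set.mem_singleton_iff, not_or] at hl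
    have h1 : l - z ≠ 0 := sub_ne_zero.mpr hl.1
    have h2 : l - star z ≠ 0 := sub_ne_zero.mpr hl.2
    have hPP := hP.idempotent
    simp only [simpleElement, Matrix.conjTranspose_add, Matrix.conjTranspose_smul,
      Matrix.conjTranspose_sub, Matrix.conjTranspose_one, hP.hermitian, star_div₀, star_sub,
      star_star, mul_add, add_mul, mul_sub, sub_mul, smul_mul_assoc, mul_smul_comm, hPP, mul_one, one_mul,
      sub_self, smul_zero, add_zero, add_sub_cancel_left, smul_smul]
    rw [show (l - z) / (l - star z) * ((l - star z) / (l - z)) = 1 by field_simp, one_smul,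
      add_sub_cancel]

theorem angleProj_conjTranspose (f : ℝ) : (angleProj f).conjTranspose = angleProj f := by
  ext i j
  fin_cases i <;> fin_cases j <;>
    simp [angleProj, Matrix.conjTranspose_apply, -Complex.ofReal_cos, -Complex.ofReal_sin]

theorem angleProj_transpose (f : ℝ) : (angleProj f).transpose = angleProj f := by
  ext i j
  fin_cases i <;> fin_cases j <;> simp [angleProj]

theorem ofReal_sin_sq_add_cos_sq (θ : ℝ) :
    ((Real.sin θ : ℝ) : ℂ) ^ 2 + ((Real.cos θ : ℝ) : ℂ) ^ 2 = 1 := by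
  exact_mod_cast Real.sin_sq_add_cos_sq θ

theorem reflMatrix_mul_self (f : ℝ) : reflMatrix f * reflMatrix f = 1 := by
  have h := ofReal_sin_sq_add_cos_sq f
  ext i j
  fin_cases i <;> fin_cases j <;>
    simp [reflMatrix, -Complex.ofReal_cos, -Complex.ofReal_sin]
  · linear_combination h
  · ring
  · ring
  · linear_combination h

theorem angleProj_mul_self (f : ℝ) : angleProj f * angleProj f = angleProj f := by
  simp only [angleProj_eq, smul_mul_smul_comm, mul_add, add_mul, mul_one, one_mul,
    reflMatrix_mul_self]
  module

theorem isHermitianProjectionOnto_angleProj (f : ℝ) :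
    IsHermitianProjectionOnto (angleProj f) (angleLine f) := by
  refine ⟨angleProj_conjTranspose f, angleProj_mul_self f, le_antisymm ?_ ?_⟩
  · rintro _ ⟨w, rfl⟩
    refine Submodule.mem_span_singleton.mpr
      ⟨((Real.cos (f / 2) : ℝ) : ℂ) * w 0 + ((Real.sin (f / 2) : ℝ) : ℂ) * w 1, ?_⟩
    ext i
    fin_cases i <;>
      simp [angleProj, Matrix.mulVec, dotProduct, Fin.sum_univ_two, -Complex.ofReal_cos,
        -Complex.ofReal_sin] <;> ring
  · refine Submodule.span_le.mpr (Set.singleton_subset_iff.mpr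
      ⟨![((Real.cos (f / 2) : ℝ) : ℂ), ((Real.sin (f / 2) : ℝ) : ℂ)], ?_⟩)
    have h := ofReal_sin_sq_add_cos_sq (f / 2)
    ext i
    fin_cases i <;>
      simp [angleProj, Matrix.mulVec, dotProduct, Fin.sum_univ_two, -Complex.ofReal_cos,
        -Complex.ofReal_sin]
    · linear_combination ((Real.cos (f / 2) : ℝ) : ℂ) * h
    · linear_combination ((Real.sin (f / 2) : ℝ) : ℂ) * h

theorem star_I_mul_ofReal (s : ℝ) : star (Complex.I * (s : ℂ)) = -(Complex.I * (s : ℂ)) := by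
  simp

/-- The projection is symmetric, and conj z = -z makes the scalar factor at -l the reciprocal of the
one at l. -/
theorem isTwistedRationalLoop_simpleElement (s f : ℝ) :
    IsTwistedRationalLoop (simpleElement (Complex.I * (s : ℂ)) (angleProj f)) := by
  refine ⟨(isHermitianProjectionOnto_angleProj f).isRationalLoop_simpleElement _, ?_⟩
  set z := Complex.I * (s : ℂ) with hz
  have : ∀ᶠ l in Filter.cofinite, l ∉ ({z, -z} : Set ℂ) :=
    (Set.toFinite {z, -z}).compl_mem_cofinite
  filter_upwards [this] with l hl
  simp only [Set.mem_insert_iff, Set.mem_singleton_iff, not_or] at hl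
  have h1 : l - z ≠ 0 := sub_ne_zero.mpr hl.1
  have h2 : l + z ≠ 0 := fun h => hl.2 (eq_neg_of_add_eq_zero_left h)
  have h3 : -l + z ≠ 0 := fun h => h1 (by linear_combination -h)
  have hPP := angleProj_mul_self f
  simp only [simpleElement, hz, star_I_mul_ofReal]
  simp only [← hz, sub_neg_eq_add, Matrix.transpose_add, Matrix.transpose_smul,
    Matrix.transpose_sub, Matrix.transpose_one, angleProj_transpose, mul_add, add_mul, mul_sub,
    sub_mul, smul_mul_assoc, mul_smul_comm, hPP, mul_one, one_mul, sub_self, smul_zero, add_zero,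
    add_sub_cancel_left, smul_smul]
  rw [show (l - z) / (l + z) * ((-l - z) / (-l + z)) = 1 by field_simp; ring, one_smul,
    add_sub_cancel]

/-- `(l - conj z) g_{z,π}(l)` as a polynomial in `l`, for `z = is`. -/
theorem smul_simpleElement (s f : ℝ) {l : ℂ} (hl : l ≠ star (Complex.I * (s : ℂ))) :
    (l - star (Complex.I * (s : ℂ))) • simpleElement (Complex.I * (s : ℂ)) (angleProj f) l =
      l • 1 + (Complex.I * (s : ℂ)) • reflMatrix f := by
  have h : l - star (Complex.I * (s : ℂ)) ≠ 0 := sub_ne_zero.mpr hl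
  rw [simpleElement, smul_add, smul_smul, mul_div_cancel₀ _ h, star_I_mul_ofReal, angleProj_eq]
  module

end SimpleElement

/-! ### The Darboux matrix intertwining the two Lax pairs -/

section Gauge

variable {q f : ℝ → ℝ → ℝ} {s : ℝ}

/-- With M = l + zR(θ), the right side is the derivative of M when θ moves at the speed p + 2s sin θ
of a Bäcklund angle: M_x = MA - ÃM. `gauge_t` is the analogue in t. -/
theorem gauge_x (l : ℂ) (s θ p : ℝ) :
    (l • 1 + (Complex.I * (s : ℂ)) • reflMatrix θ) * (l • sgA + ((p / 2 : ℝ) : ℂ) • sgJ) -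
      (l • sgA + (((p + 4 * s * Real.sin θ) / 2 : ℝ) : ℂ) • sgJ) *
        (l • 1 + (Complex.I * (s : ℂ)) • reflMatrix θ) =
      (Complex.I * (s : ℂ) * ((p + 2 * s * Real.sin θ : ℝ) : ℂ)) • reflMatrixDeriv θ := by
  have hI := Complex.I_sq
  ext i j
  fin_cases i <;> fin_cases j <;>
    simp [Matrix.one_fin_two, reflMatrix, reflMatrixDeriv, sgA, sgJ, -Complex.ofReal_cos, -Complex.ofReal_sin] <;>
    ring_nf <;> simp only [hI] <;> ring

theorem gauge_t {l : ℂ} (hl : l ≠ 0) {s : ℝ} (hs : s ≠ 0) (θ φ : ℝ) :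
    (l • 1 + (Complex.I * (s : ℂ)) • reflMatrix θ) * (l⁻¹ • sgQ φ) -
      (l⁻¹ • sgQ (2 * θ - φ)) * (l • 1 + (Complex.I * (s : ℂ)) • reflMatrix θ) =
      (Complex.I * (s : ℂ) * ((1 / (2 * s) * Real.sin (θ - φ) : ℝ) : ℂ)) • reflMatrixDeriv θ := by
  have hI := Complex.I_sq
  have hs' : (s : ℂ) ≠ 0 := by exact_mod_cast hs
  obtain ⟨d, rfl⟩ : ∃ d, φ = θ - d := ⟨θ - φ, by ring⟩
  rw [show 2 * θ - (θ - d) = θ + d by ring, show θ - (θ - d) = d by ring]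
  ext i j
  fin_cases i <;> fin_cases j <;>
    simp [Matrix.one_fin_two, reflMatrix, reflMatrixDeriv, sgQ, Real.cos_add, Real.cos_sub,
      Real.sin_add, Real.sin_sub, -Complex.ofReal_cos, -Complex.ofReal_sin] <;>
    field_simp <;> ring

/-- The Darboux matrix intertwines the trivializations of `q` and of its Bäcklund transform. -/
theorem IsBacklundAngle.gauge (hf : IsBacklundAngle s q f) (hq : IsSineGordon q) (hs : s ≠ 0)
    {E E' : ℝ → ℝ → ℂ → Matrix (Fin 2) (Fin 2) ℂ} (hE : IsLaxFrame q E)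
    (hE' : IsLaxFrame (fun x t => 2 * f x t - q x t) E') (x t : ℝ) {l : ℂ} (hl : l ≠ 0) :
    (l • 1 + (Complex.I * (s : ℂ)) • reflMatrix (f 0 0)) * E x t l =
      E' x t l * (l • 1 + (Complex.I * (s : ℂ)) • reflMatrix (f x t)) := by
  have hl' : star l ≠ 0 := star_ne_zero.mpr hl
  have hM : ∀ {θ : ℝ → ℝ} {θ' y : ℝ}, HasDerivAt θ θ' y →
      HasMatDerivAt (fun y => l • 1 + (Complex.I * (s : ℂ)) • reflMatrix (θ y))
        ((Complex.I * (s : ℂ) * (θ' : ℂ)) • reflMatrixDeriv (θ y)) y := fun h =>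
    ((hasMatDerivAt_const (l • 1) _).add (hasMatDerivAt_smul_reflMatrix h _)).congr_deriv
      (zero_add _)
  -- The adjoint of E at conj l stands for E⁻¹, so this is the constancy of E' M E⁻¹.
  have key := eq_of_hasMatDerivAt_zero (F := fun x t => E' x t l *
    (l • 1 + (Complex.I * (s : ℂ)) • reflMatrix (f x t)) * (E x t (star l)).conjTranspose)
    (fun x t => ?_) (fun x t => ?_) x t
  · have h1 := congrArg (· * E x t l) key
    simp only [hE.base _ hl', hE'.base l hl, Matrix.conjTranspose_one, mul_one, one_mul] at h1
    rw [← h1, mul_assoc, hE.conjTranspose_mul x t hl, mul_one]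
  · refine ((((hE'.deriv_x x t l hl).mul (hM (hf.deriv_x x t))).mul
      (hE.deriv_x x t _ hl').conjTranspose).congr_deriv ?_)
    rw [Matrix.conjTranspose_mul, Matrix.conjTranspose_add, Matrix.conjTranspose_smul, star_star,
      sgA_conjTranspose, sgPotential_conjTranspose, ← gauge_x l, sgPotential_eq, sgPotential_eq,
      hf.deriv_transform hq, smul_neg, ← neg_add]
    generalize l • sgA + ((deriv (fun y => q y t) x / 2 : ℝ) : ℂ) • sgJ = A
    noncomm_ring
  · refine ((((hE'.deriv_t x t l hl).mul (hM (hf.deriv_t x t))).mul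
      (hE.deriv_t x t _ hl').conjTranspose).congr_deriv ?_)
    rw [Matrix.conjTranspose_mul, Matrix.conjTranspose_smul, sgQ_conjTranspose, star_inv₀,
      star_star, ← gauge_t hl hs, smul_neg]
    generalize l⁻¹ • sgQ (q x t) = A
    noncomm_ring

/-- At l = z the Darboux matrix is 2z times the projection, so the gauge identity becomes πE = E'π̃.
Taking adjoints gives E*π = π̃E'*, and E'* is onto, so both sides have the range of π̃. -/
theorem IsBacklundAngle.isHermitianProjectionOnto (hf : IsBacklundAngle s q f)
    (hq : IsSineGordon q) (hs : s ≠ 0) {E : ℝ → ℝ → ℂ → Matrix (Fin 2) (Fin 2) ℂ}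
    (hE : IsLaxFrame q E) (x t : ℝ) :
    IsHermitianProjectionOnto (angleProj (f x t)) ((angleLine (f 0 0)).map
      (Matrix.toLin' (E x t (Complex.I * (s : ℂ))).conjTranspose)) := by
  obtain ⟨E', hE', -⟩ := (hf.isSineGordon hs hq).exists_isLaxFrame
  have hz : Complex.I * (s : ℂ) ≠ 0 := mul_ne_zero Complex.I_ne_zero (by exact_mod_cast hs)
  have h := hf.gauge hq hs hE hE' x t hz
  have h1 : angleProj (f 0 0) * E x t (Complex.I * (s : ℂ)) =
      E' x t (Complex.I * (s : ℂ)) * angleProj (f x t) := by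
    simp only [← smul_add, smul_mul_assoc, mul_smul_comm] at h
    simp only [angleProj_eq, smul_mul_assoc, mul_smul_comm, smul_right_injective _ hz h]
  have h2 := congrArg Matrix.conjTranspose h1
  simp only [Matrix.conjTranspose_mul, angleProj_conjTranspose] at h2
  refine ⟨angleProj_conjTranspose _, angleProj_mul_self _, ?_⟩
  have hinv : (E' x t (Complex.I * (s : ℂ))).conjTranspose *
      E' x t (star (Complex.I * (s : ℂ))) = 1 := by
    have := hE'.conjTranspose_mul x t (star_ne_zero.mpr hz)
    rwa [star_star] at this
  have htop : LinearMap.range (Matrix.toLin' (E' x t (Complex.I * (s : ℂ))).conjTranspose) = ⊤ := by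
    refine LinearMap.range_eq_top.mpr fun w =>
      ⟨Matrix.toLin' (E' x t (star (Complex.I * (s : ℂ)))) w, ?_⟩
    rw [← LinearMap.comp_apply, ← Matrix.toLin'_mul, hinv, Matrix.toLin'_one, LinearMap.id_apply]
  rw [← (isHermitianProjectionOnto_angleProj (f 0 0)).range_eq, ← LinearMap.range_comp,
    ← Matrix.toLin'_mul, h2, Matrix.toLin'_mul, LinearMap.range_comp_of_range_eq_top _ htop]

end Gauge

/-! ### Frames of the -1 flow: existence and independence of the choice -/

section Frames

variable {q : ℝ → ℝ → ℝ}

theorem sgPotential_transpose (q : ℝ → ℝ → ℝ) (x t : ℝ) :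
    (sgPotential q x t).transpose = -sgPotential q x t := by
  ext i j
  fin_cases i <;> fin_cases j <;> simp [sgPotential]

theorem sgPotential_mem_twistedPerp (q : ℝ → ℝ → ℝ) (x t : ℝ) :
    sgPotential q x t ∈ twistedPerp sgA := by
  refine ⟨sgPotential_conjTranspose q x t, ?_, ?_, ?_⟩
  · simp [sgPotential, Matrix.trace_fin_two]
  · rw [sgPotential_transpose, neg_neg]
  · simp [sgPotential, sgA, Matrix.trace_fin_two]

theorem hasMatDerivAt_sgFrame (hq : IsSineGordon q) (x t : ℝ) :
    HasMatDerivAt (fun y => sgFrame q y t) (sgFrame q x t * sgPotential q x t) x := by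
  have h := (hasDerivAt_fst hq.smooth x t).div_const 2
  have hc := h.cos.ofReal_comp
  have hs := h.sin.ofReal_comp
  have hns := h.sin.neg.ofReal_comp
  intro i j
  fin_cases i <;> fin_cases j
  · exact hc.congr_deriv (by simp [sgFrame, sgPotential])
  · exact hs.congr_deriv (by simp [sgFrame, sgPotential])
  · exact hns.congr_deriv (by simp [sgFrame, sgPotential])
  · exact hc.congr_deriv (by simp [sgFrame, sgPotential])

theorem isUnit_det_sgFrame (q : ℝ → ℝ → ℝ) (x t : ℝ) : IsUnit (sgFrame q x t).det :=
  (Matrix.isUnit_iff_isUnit_det _).mp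
    (IsUnit.of_mul_eq_one_right _ (sgFrame_mul_transpose q x t))

theorem conj_smul_sgFrame (q : ℝ → ℝ → ℝ) (x t : ℝ) {c : ℂ} (hc : c * c = 1) :
    (c • sgFrame q x t)⁻¹ * sgB * (c • sgFrame q x t) = sgQ (q x t) := by
  have h : (c • sgFrame q x t)⁻¹ = c • (sgFrame q x t)⁻¹ := by
    refine Matrix.inv_eq_left_inv ?_
    rw [smul_mul_smul_comm, hc, one_smul, sgFrame_inv, sgFrame_mul_transpose]
  rw [h, smul_mul_assoc, smul_mul_smul_comm, hc, one_smul, sgFrame_conj]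

theorem hasMatDerivAt_sgPotential (hq : IsSineGordon q) (x t : ℝ) :
    HasMatDerivAt (fun τ => sgPotential q x τ) (sgA * sgQ (q x t) - sgQ (q x t) * sgA) t := by
  rw [sgA_commutator_sgQ]
  simp only [sgPotential_eq]
  intro i j
  simp only [Matrix.smul_apply, smul_eq_mul]
  exact (((hq.hasDerivAt_deriv x t).div_const 2).ofReal_comp).mul_const _

/-- The frame of a sine-Gordon solution, up to a sign depending on `t`, is a frame for the
`-1` flow. -/
theorem isMinusOneFlow_smul_sgFrame (hq : IsSineGordon q) {c : ℝ → ℂ} (hc : ∀ t, c t * c t = 1) :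
    IsMinusOneFlow sgA sgB (sgPotential q) (fun x t => c t • sgFrame q x t) := by
  refine ⟨fun i j => ?_, fun x t => ?_, fun x t => ?_, fun x t => ?_⟩
  · simp only [sgPotential_eq, Matrix.smul_apply, smul_eq_mul]
    exact (Complex.ofRealCLM.contDiff.comp
      ((contDiff_deriv_fst hq.smooth).div_const 2)).mul contDiff_const
  · rw [Matrix.det_smul]
    exact ((IsUnit.of_mul_eq_one _ (hc t)).pow _).mul (isUnit_det_sgFrame q x t)
  · rw [smul_mul_assoc]
    exact (hasMatDerivAt_sgFrame hq x t).const_smul (c t)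
  · rw [conj_smul_sgFrame q x t (hc t)]
    exact hasMatDerivAt_sgPotential hq x t

theorem isSineGordonFrame_sgFrame (hq : IsSineGordon q) : IsSineGordonFrame q (sgFrame q) := by
  have := isMinusOneFlow_smul_sgFrame hq (c := fun _ => 1) (fun _ => one_mul 1)
  simp only [one_smul] at this
  exact ⟨this, Or.inl rfl⟩

theorem tendsto_sgFrame {t : ℝ} {k : ℤ}
    (h : Filter.Tendsto (fun x => q x t) Filter.atBot (𝓝 (2 * Real.pi * k))) :
    Filter.Tendsto (fun x => sgFrame q x t) Filter.atBot (𝓝 ((-1 : ℂ) ^ k • 1)) := by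
  have h2 : Filter.Tendsto (fun x => q x t / 2) Filter.atBot (𝓝 (k * Real.pi)) := by
    have := h.div_const 2
    rwa [show 2 * Real.pi * k / 2 = k * Real.pi by ring] at this
  have hc : Filter.Tendsto (fun x => ((Real.cos (q x t / 2) : ℝ) : ℂ)) Filter.atBot
      (𝓝 ((-1 : ℂ) ^ k)) := by
    have := (Complex.continuous_ofReal.tendsto _).comp ((Real.continuous_cos.tendsto _).comp h2)
    simpa [Real.cos_int_mul_pi, -Complex.ofReal_cos, Function.comp_def] using this
  have hs : Filter.Tendsto (fun x => ((Real.sin (q x t / 2) : ℝ) : ℂ)) Filter.atBot (𝓝 0) := by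
    have := (Complex.continuous_ofReal.tendsto _).comp ((Real.continuous_sin.tendsto _).comp h2)
    simpa [Real.sin_int_mul_pi, -Complex.ofReal_sin, Function.comp_def] using this
  refine tendsto_pi_nhds.mpr fun i => tendsto_pi_nhds.mpr fun j => ?_
  fin_cases i <;> fin_cases j <;>
    simp [sgFrame, -Complex.ofReal_cos, -Complex.ofReal_sin]
  · exact hc
  · exact hs
  · simpa using hs.neg
  · exact hc

theorem neg_one_zpow_mul_self (k : ℤ) : ((-1 : ℂ) ^ k) * (-1 : ℂ) ^ k = 1 := by
  rw [← mul_zpow]; simp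

theorem exists_normalized_frame (hq : IsSineGordon q) (hv : VanishesAtBot q) :
    ∃ g, IsSineGordonFrame q g ∧ IsNormalizedFrame g := by
  choose k hk using hv
  -- The frame tends to (-1)^k with k depending on t; multiplying by that sign normalizes it. No
  -- regularity of k is needed, since frames are differentiated only in x.
  have hn : IsNormalizedFrame (fun x t => ((-1 : ℂ) ^ k t) • sgFrame q x t) := fun t => by
    have := (tendsto_sgFrame (hk t)).const_smul ((-1 : ℂ) ^ k t)
    rwa [smul_smul, neg_one_zpow_mul_self, one_smul] at this
  exact ⟨_, ⟨isMinusOneFlow_smul_sgFrame hq fun t => neg_one_zpow_mul_self (k t),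
    Or.inr ⟨fun t => ⟨k t, hk t⟩, hn⟩⟩, hn⟩

/-- All admissible frames define the same matrix `g⁻¹ b g`. -/
theorem IsSineGordonFrame.conj_eq {g : ℝ → ℝ → Matrix (Fin 2) (Fin 2) ℂ}
    (hg : IsSineGordonFrame q g) (hq : IsSineGordon q) (x t : ℝ) :
    (g x t)⁻¹ * sgB * g x t = sgQ (q x t) := by
  obtain ⟨hflow, rfl | ⟨hv, hn⟩⟩ := hg
  · exact sgFrame_conj q x t
  obtain ⟨k, hk⟩ := hv t
  have hF' : ∀ x, HasMatDerivAt (fun y => (sgFrame q y t).transpose)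
      (sgFrame q x t * sgPotential q x t).transpose x := fun x i j =>
    hasMatDerivAt_sgFrame hq x t j i
  -- Both frames solve Y_x = Yu with u skew, so their quotient does not depend on x; its limit at -∞
  -- then shows that it is a sign.
  have hconst : ∀ x, g x t * (sgFrame q x t).transpose = g 0 t * (sgFrame q 0 t).transpose :=
    fun x => eq_of_hasMatDerivAt_zero (F := fun x _ => g x t * (sgFrame q x t).transpose)
      (fun x _ => ((hflow.frame_x x t).mul (hF' x)).congr_deriv (by
        rw [Matrix.transpose_mul, sgPotential_transpose]
        noncomm_ring)) (fun x _ => hasMatDerivAt_const _ _) x t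
  have hlim : g 0 t * (sgFrame q 0 t).transpose = (-1 : ℂ) ^ k • 1 := by
    have h1 : Filter.Tendsto (fun x => g x t * (sgFrame q x t).transpose) Filter.atBot
        (𝓝 (1 * ((-1 : ℂ) ^ k • (1 : Matrix (Fin 2) (Fin 2) ℂ)).transpose)) :=
      (hn t).mul ((continuous_id.matrix_transpose.tendsto _).comp (tendsto_sgFrame hk))
    simp only [hconst] at h1
    rw [tendsto_nhds_unique tendsto_const_nhds h1]
    simp
  have hgx : g x t = (-1 : ℂ) ^ k • sgFrame q x t := by
    rw [← hconst x] at hlim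
    have := congrArg (· * sgFrame q x t) hlim
    simpa [mul_assoc, sgFrame_mul_transpose] using this
  rw [hgx]
  exact conj_smul_sgFrame q x t (neg_one_zpow_mul_self k)

theorem IsSineGordonFrame.isTrivialization_iff {g : ℝ → ℝ → Matrix (Fin 2) (Fin 2) ℂ}
    (hg : IsSineGordonFrame q g) (hq : IsSineGordon q)
    {E : ℝ → ℝ → ℂ → Matrix (Fin 2) (Fin 2) ℂ} :
    IsTrivialization sgA sgB (sgPotential q) g E ↔ IsLaxFrame q E :=
  ⟨fun h => ⟨h.base, h.deriv_x, fun x t l hl => by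
      simpa only [hg.conj_eq hq] using h.deriv_t x t l hl⟩,
    fun h => ⟨h.base, h.deriv_x, fun x t l hl => by
      simpa only [hg.conj_eq hq] using h.deriv_t x t l hl⟩⟩

end Frames

end LoopSG

namespace LoopSG

/-! ### Uniqueness of the Birkhoff factorization -/

section Factorization

variable {n : Type*} [Fintype n] [DecidableEq n]

theorem meromorphicAt_of_eventuallyEq_div {f : ℂ → ℂ} {d p : Polynomial ℂ} (hd : d ≠ 0)
    (h : ∀ l, d.eval l ≠ 0 → f l = p.eval l / d.eval l) (c : ℂ) : MeromorphicAt f c := by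
  have hm : MeromorphicAt (fun l => p.eval l / d.eval l) c :=
    (p.differentiable.analyticAt c).meromorphicAt.fun_div (d.differentiable.analyticAt c).meromorphicAt
  refine hm.congr ?_
  have hfin : ∀ᶠ l in Filter.cofinite, d.eval l ≠ 0 := by
    have := (Polynomial.finite_setOfPred_isRoot hd).compl_mem_cofinite
    filter_upwards [this] with l hl using hl
  filter_upwards [nhdsNE_le_cofinite c hfin] with l hl using (h l hl).symm

theorem IsRationalLoop.meromorphicAt {g : ℂ → Matrix n n ℂ} (hg : IsRationalLoop g) (i j : n)
    (c : ℂ) : MeromorphicAt (fun l => g l i j) c := by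
  obtain ⟨d, P, hd, h⟩ := hg.rational
  exact meromorphicAt_of_eventuallyEq_div hd (fun l hl => h l hl i j) c

theorem IsRationalLoop.meromorphicAt_conj {g : ℂ → Matrix n n ℂ} (hg : IsRationalLoop g) (i j : n)
    (c : ℂ) : MeromorphicAt (fun l => (g (star l)).conjTranspose i j) c := by
  obtain ⟨d, P, hd, h⟩ := hg.rational
  have hev : ∀ (p : Polynomial ℂ) (l : ℂ),
      (p.map (starRingEnd ℂ)).eval l = starRingEnd ℂ (p.eval (star l)) := fun p l => by
    rw [Polynomial.eval_map, ← Polynomial.eval₂_at_apply]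
    simp
  refine meromorphicAt_of_eventuallyEq_div (d := d.map (starRingEnd ℂ))
    (p := (P j i).map (starRingEnd ℂ))
    ((Polynomial.map_ne_zero_iff (starRingEnd ℂ).injective).mpr hd) (fun l hl => ?_) c
  rw [hev] at hl ⊢
  rw [hev, Matrix.conjTranspose_apply, h (star l) (fun h0 => hl (by rw [h0, map_zero])) j i]
  exact map_div₀ (starRingEnd ℂ) _ _

theorem IsRationalLoop.tendsto_conj {g : ℂ → Matrix n n ℂ} (hg : IsRationalLoop g) :
    Filter.Tendsto (fun l => (g (star l)).conjTranspose) (Filter.cocompact ℂ) (𝓝 1) := by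
  have h1 : Filter.Tendsto (fun l : ℂ => star l) (Filter.cocompact ℂ) (Filter.cocompact ℂ) :=
    (Complex.conjLIE.toHomeomorph).isClosedEmbedding.tendsto_cocompact
  have h2 := (continuous_id.matrix_conjTranspose.tendsto _).comp (hg.at_infinity.comp h1)
  rwa [id, Matrix.conjTranspose_one] at h2

theorem IsPlusLoop.mul_conjTranspose {F : ℂ → Matrix n n ℂ} (hF : IsPlusLoop F) {l : ℂ}
    (hl : l ≠ 0) : F l * (F (star l)).conjTranspose = 1 :=
  mul_eq_one_comm.mp (hF.reality l hl)

/-- Uniqueness of the Birkhoff factorization into a loop holomorphic on `ℂ ∖ {0}` and a rational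
loop. The factor at `0` is controlled by unitarity on the real line. -/
theorem IsPlusLoop.eq_of_factorization {F G m k : ℂ → Matrix n n ℂ} (hF : IsPlusLoop F)
    (hG : IsPlusLoop G) (hm : IsRationalLoop m) (hk : IsRationalLoop k)
    (h : ∀ᶠ l in Filter.cofinite, F l * m l = G l * k l) {l : ℂ} (hl : l ≠ 0) : F l = G l := by
  -- H is G⁻¹F, with the inverse supplied by the reality condition; off finitely many points it also
  -- equals k m⁻¹.
  set H : ℂ → Matrix n n ℂ := fun l => (G (star l)).conjTranspose * F l with hH
  have hH1 : ∀ l, l ≠ 0 → F l = G l * H l := fun l hl => by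
    rw [hH, ← mul_assoc, hG.mul_conjTranspose hl, one_mul]
  have hHeq : ∀ᶠ l in Filter.cofinite, H l = k l * (m (star l)).conjTranspose := by
    filter_upwards [h, hm.reality, (Set.finite_singleton (0 : ℂ)).compl_mem_cofinite]
      with l h1 h2 h3
    have h4 : m l * (m (star l)).conjTranspose = 1 := mul_eq_one_comm.mp h2
    calc H l = (G (star l)).conjTranspose * (F l * m l) * (m (star l)).conjTranspose := by
          rw [hH, mul_assoc, mul_assoc, h4, mul_one]
      _ = (G (star l)).conjTranspose * G l * (k l * (m (star l)).conjTranspose) := by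
          rw [h1]; simp only [mul_assoc]
      _ = _ := by rw [hG.reality l h3, one_mul]
  have hHd : ∀ i j l, l ≠ 0 → DifferentiableAt ℂ (fun l => H l i j) l := by
    intro i j l hl
    simp only [hH, Matrix.mul_apply, Matrix.conjTranspose_apply]
    refine DifferentiableAt.fun_sum fun p _ => DifferentiableAt.mul ?_
      ((hF.holomorphic p j).differentiableAt (isOpen_compl_singleton.mem_nhds hl))
    have hl' : star l ≠ 0 := star_ne_zero.mpr hl
    have h1 := (((hG.holomorphic p i).differentiableAt
      (isOpen_compl_singleton.mem_nhds hl'))).star_star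
    rw [star_star] at h1
    exact h1
  have hHlim : Filter.Tendsto H (Filter.cocompact ℂ) (𝓝 1) := by
    have := hk.at_infinity.mul hm.tendsto_conj
    rw [one_mul] at this
    refine this.congr' ?_
    filter_upwards [Filter.cocompact_le_cofinite hHeq] with l hl using hl.symm
  have hHreal : ∀ r : ℝ, r ≠ 0 → ∀ i j, ‖H r i j‖ ≤ 1 := by
    intro r hr i j
    have hr' : (r : ℂ) ≠ 0 := by exact_mod_cast hr
    have hstar : star (r : ℂ) = r := Complex.conj_ofReal r
    refine entry_norm_bound_of_unitary (Matrix.mem_unitaryGroup_iff'.mpr ?_) i j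
    have h1 := hG.mul_conjTranspose hr'
    have h2 := hF.reality _ hr'
    rw [hstar] at h1 h2
    simp only [hH, hstar, Matrix.star_eq_conjTranspose, Matrix.conjTranspose_mul,
      Matrix.conjTranspose_conjTranspose]
    rw [mul_assoc, ← mul_assoc (G r), h1, one_mul, h2]
  have hHmero : ∀ i j, MeromorphicAt (fun l => H l i j) 0 := by
    intro i j
    have h1 : MeromorphicAt (fun l => ∑ p, k l i p * (m (star l)).conjTranspose p j) 0 :=
      MeromorphicAt.fun_sum fun p _ => (hk.meromorphicAt i p 0).fun_mul (hm.meromorphicAt_conj p j 0)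
    refine h1.congr ?_
    filter_upwards [nhdsNE_le_cofinite 0 hHeq] with l hl
    rw [hl, Matrix.mul_apply]
  -- H is meromorphic at 0 as a product of rational loops there. A pole would force the entry to
  -- blow up along the real axis, where unitarity bounds it by 1.
  have hH0 : ∀ i j, ∃ c, Filter.Tendsto (fun l => H l i j) (𝓝[≠] 0) (𝓝 c) := by
    intro i j
    rw [tendsto_nhds_iff_meromorphicOrderAt_nonneg (hHmero i j), ← not_lt,
      ← tendsto_cobounded_iff_meromorphicOrderAt_neg (hHmero i j),
      ← tendsto_norm_atTop_iff_cobounded]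
    intro hinf
    have hr : Filter.Tendsto (fun r : ℝ => (r : ℂ)) (𝓝[≠] 0) (𝓝[≠] 0) := by
      refine tendsto_nhdsWithin_of_tendsto_nhds_of_eventually_within _ ?_ ?_
      · have := (Complex.continuous_ofReal.tendsto 0).mono_left (nhdsWithin_le_nhds (s := {0}ᶜ))
        simpa using this
      · filter_upwards [self_mem_nhdsWithin] with r hr
        simpa using hr
    obtain ⟨r, hr1, hr2⟩ := (((hinf.comp hr).eventually_gt_atTop 1).and
      self_mem_nhdsWithin).exists
    exact absurd (hHreal r hr2 i j) (not_le.mpr hr1)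
  have hHone : H l = 1 := by
    ext i j
    obtain ⟨c, hc⟩ := hH0 i j
    set g := Function.update (fun l => H l i j) 0 c with hg
    have hgd : ∀ l, l ≠ 0 → DifferentiableAt ℂ g l := fun l hl =>
      (hHd i j l hl).congr_of_eventuallyEq
        (by filter_upwards [isOpen_compl_singleton.mem_nhds hl] with w hw
            exact Function.update_of_ne hw _ _)
    have hgdiff : Differentiable ℂ g := by
      intro w
      rcases eq_or_ne w 0 with rfl | hw
      · refine (Complex.analyticAt_of_differentiable_on_punctured_nhds_of_continuousAt ?_
          (continuousAt_update_same.mpr hc)).differentiableAt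
        filter_upwards [self_mem_nhdsWithin] with w hw using hgd w hw
      · exact hgd w hw
    have hglim : Filter.Tendsto g (Filter.cocompact ℂ) (𝓝 ((1 : Matrix n n ℂ) i j)) := by
      have h1 := tendsto_pi_nhds.mp (tendsto_pi_nhds.mp hHlim i) j
      refine h1.congr' ?_
      filter_upwards [Filter.cocompact_le_cofinite
        (Set.finite_singleton (0 : ℂ)).compl_mem_cofinite] with w hw
      exact (Function.update_of_ne hw c fun l => H l i j).symm
    -- Liouville: an entire function with a limit at ∞ is constant.
    rw [← hgdiff.apply_eq_of_tendsto_cocompact l hglim, hg, Function.update_of_ne hl]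
  rw [hH1 l hl, hHone, mul_one]

end Factorization

/-! ### The dressing action of the simple element -/

section Dressing

variable {q f : ℝ → ℝ → ℝ} {s : ℝ}

theorem IsLaxFrame.isPlusLoop {E : ℝ → ℝ → ℂ → Matrix (Fin 2) (Fin 2) ℂ} (hE : IsLaxFrame q E)
    (hd : ∀ x t i j, DifferentiableOn ℂ (fun l => E x t l i j) {0}ᶜ) (x t : ℝ) :
    IsPlusLoop (E x t) :=
  ⟨hd x t, fun _ hl => (Matrix.isUnit_iff_isUnit_det _).mp
    (IsUnit.of_mul_eq_one _ (hE.mul_conjTranspose x t hl)), fun _ hl => hE.conjTranspose_mul x t hl⟩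

theorem IsBacklundAngle.factorization (hf : IsBacklundAngle s q f) (hq : IsSineGordon q)
    (hs : s ≠ 0) {E E' : ℝ → ℝ → ℂ → Matrix (Fin 2) (Fin 2) ℂ} (hE : IsLaxFrame q E)
    (hE' : IsLaxFrame (fun x t => 2 * f x t - q x t) E') (x t : ℝ) :
    ∀ᶠ l in Filter.cofinite,
      simpleElement (Complex.I * (s : ℂ)) (angleProj (f 0 0)) l * E x t l =
        E' x t l * simpleElement (Complex.I * (s : ℂ)) (angleProj (f x t)) l := by
  filter_upwards [(Set.toFinite {0, star (Complex.I * (s : ℂ))}).compl_mem_cofinite] with l hl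
  simp only [Set.mem_compl_iff, Set.mem_insert_iff, Set.mem_singleton_iff, not_or] at hl
  have h := hf.gauge hq hs hE hE' x t hl.1
  rw [← smul_simpleElement s _ hl.2, ← smul_simpleElement s _ hl.2, smul_mul_assoc,
    mul_smul_comm] at h
  exact smul_right_injective _ (sub_ne_zero.mpr hl.2) h

theorem IsBacklundAngle.isDressing (hf : IsBacklundAngle s q f) (hq : IsSineGordon q)
    (hs : s ≠ 0) {g : ℝ → ℝ → Matrix (Fin 2) (Fin 2) ℂ} (hg : IsSineGordonFrame q g) :
    IsDressing sgA sgB (sgPotential q) g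
      (simpleElement (Complex.I * (s : ℂ)) (angleProj (f 0 0)))
      (sgPotential fun x t => 2 * f x t - q x t) := by
  obtain ⟨E, hE, -⟩ := hq.exists_isLaxFrame
  obtain ⟨E', hE', hd⟩ := (hf.isSineGordon hs hq).exists_isLaxFrame
  exact ⟨E, E', fun x t => simpleElement (Complex.I * (s : ℂ)) (angleProj (f x t)),
    (hg.isTrivialization_iff hq).mpr hE, hE'.isPlusLoop hd,
    fun x t => (isTwistedRationalLoop_simpleElement s (f x t)).toIsRationalLoop,
    hf.factorization hq hs hE hE', hE'.deriv_x⟩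

theorem IsBacklundAngle.isDressing_unique (hf : IsBacklundAngle s q f) (hq : IsSineGordon q)
    (hs : s ≠ 0) {g v : ℝ → ℝ → Matrix (Fin 2) (Fin 2) ℂ} (hg : IsSineGordonFrame q g)
    (hv : IsDressing sgA sgB (sgPotential q) g
      (simpleElement (Complex.I * (s : ℂ)) (angleProj (f 0 0))) v) :
    v = sgPotential fun x t => 2 * f x t - q x t := by
  obtain ⟨E, F, m, hE, hF, hm, hfac, hFx⟩ := hv
  rw [hg.isTrivialization_iff hq] at hE
  obtain ⟨E', hE', hd⟩ := (hf.isSineGordon hs hq).exists_isLaxFrame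
  have heq : ∀ x t l, l ≠ 0 → F x t l = E' x t l := fun x t l hl =>
    (hF x t).eq_of_factorization (hE'.isPlusLoop hd x t) (hm x t)
      (isTwistedRationalLoop_simpleElement s (f x t)).toIsRationalLoop (by
        filter_upwards [hfac x t, hf.factorization hq hs hE hE' x t] with l h1 h2
        rw [← h1, h2]) hl
  funext x t
  -- Once the plus factors agree, a single value of l determines v; l = 1 is as good as any.
  have h1 := hFx x t 1 one_ne_zero
  simp only [heq _ _ _ one_ne_zero] at h1
  have h2 := h1.unique (hE'.deriv_x x t 1 one_ne_zero)
  have h3 := congrArg ((E' x t (star 1)).conjTranspose * ·) h2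
  simp only [← mul_assoc, hE'.conjTranspose_mul x t one_ne_zero, one_mul] at h3
  exact add_left_cancel h3

end Dressing

/-! ### The first order system for the projection -/

section ProjectionSystem

variable {q f : ℝ → ℝ → ℝ} {s : ℝ}

theorem sgPotential_transform (hf : IsBacklundAngle s q f) (hq : IsSineGordon q) (x t : ℝ) :
    sgPotential (fun x t => 2 * f x t - q x t) x t = sgPotential q x t +
      (Complex.I * (s : ℂ) - star (Complex.I * (s : ℂ))) •
        (angleProj (f x t) * sgA - sgA * angleProj (f x t)) := by
  rw [sgPotential_eq, sgPotential_eq, hf.deriv_transform hq, angleProj_eq, star_I_mul_ofReal]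
  have hI := Complex.I_sq
  ext i j
  fin_cases i <;> fin_cases j <;>
    simp [Matrix.one_fin_two, reflMatrix, sgA, sgJ, -Complex.ofReal_cos, -Complex.ofReal_sin]
  · exact Or.inr (by ring)
  · linear_combination 2 * (s : ℂ) * ((Real.sin (f x t) : ℝ) : ℂ) * hI
  · linear_combination -2 * (s : ℂ) * ((Real.sin (f x t) : ℝ) : ℂ) * hI
  · exact Or.inr (by ring)

/-- The right side is the derivative of the projection when its angle moves at speed p + 2s sin θ,
so this x-equation is that of a Bäcklund angle. `projection_t` plays the same role in t. -/
theorem projection_x (s θ p : ℝ) :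
    (star (Complex.I * (s : ℂ)) - Complex.I * (s : ℂ)) •
        ((angleProj θ * sgA - sgA * angleProj θ) * angleProj θ) -
      (((Complex.I * (s : ℂ)) • sgA + ((p / 2 : ℝ) : ℂ) • sgJ) * angleProj θ -
        angleProj θ * ((Complex.I * (s : ℂ)) • sgA + ((p / 2 : ℝ) : ℂ) • sgJ)) =
      (1 / 2 * ((p + 2 * s * Real.sin θ : ℝ) : ℂ)) • reflMatrixDeriv θ := by
  rw [angleProj_eq, star_I_mul_ofReal]
  have hI := Complex.I_sq
  ext i j
  fin_cases i <;> fin_cases j <;>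
    simp [Matrix.one_fin_two, reflMatrix, reflMatrixDeriv, sgA, sgJ, -Complex.ofReal_cos,
      -Complex.ofReal_sin] <;>
    ring_nf <;> simp only [hI] <;> ring

theorem projection_t {s : ℝ} (hs : s ≠ 0) (θ φ : ℝ) :
    (((‖Complex.I * (s : ℂ)‖ ^ 2 : ℝ) : ℂ)⁻¹ •
      ((Complex.I * (s : ℂ) - star (Complex.I * (s : ℂ))) • (angleProj θ * sgQ φ * angleProj θ)
        - (Complex.I * (s : ℂ)) • (sgQ φ * angleProj θ)
        + star (Complex.I * (s : ℂ)) • (angleProj θ * sgQ φ))) =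
      (1 / 2 * ((1 / (2 * s) * Real.sin (θ - φ) : ℝ) : ℂ)) • reflMatrixDeriv θ := by
  have hnorm : ((‖Complex.I * (s : ℂ)‖ ^ 2 : ℝ) : ℂ) = (s : ℂ) ^ 2 := by
    rw [norm_mul, Complex.norm_I, one_mul, Complex.norm_real, Real.norm_eq_abs, sq_abs]
    push_cast
    rfl
  have hs' : (s : ℂ) ≠ 0 := by exact_mod_cast hs
  rw [angleProj_eq, star_I_mul_ofReal, hnorm]
  have hI := Complex.I_sq
  obtain ⟨d, rfl⟩ : ∃ d, φ = θ - d := ⟨θ - φ, by ring⟩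
  rw [show θ - (θ - d) = d by ring]
  have h := ofReal_sin_sq_add_cos_sq θ
  set C := ((Real.cos θ : ℝ) : ℂ) with hC
  set S := ((Real.sin θ : ℝ) : ℂ) with hS
  have hC2 : C ^ 2 = 1 - S ^ 2 := by linear_combination h
  have hC3 : C ^ 3 = C * (1 - S ^ 2) := by rw [← hC2]; ring
  ext i j
  fin_cases i <;> fin_cases j <;>
    simp [Matrix.one_fin_two, reflMatrix, reflMatrixDeriv, sgQ, Real.cos_sub, Real.sin_sub, ← hC,
      ← hS, -Complex.ofReal_cos, -Complex.ofReal_sin] <;>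
    field_simp <;> ring_nf <;> simp only [hI, hC2, hC3] <;> ring

theorem hasMatDerivAt_angleProj {θ : ℝ → ℝ} {θ' x : ℝ} (h : HasDerivAt θ θ' x) :
    HasMatDerivAt (fun y => angleProj (θ y)) ((1 / 2 * (θ' : ℂ)) • reflMatrixDeriv (θ x)) x := by
  simp only [angleProj_eq, smul_add]
  exact ((hasMatDerivAt_const _ x).add (hasMatDerivAt_smul_reflMatrix h _)).congr_deriv
    (zero_add _)

/-- Sine and cosine have no common zero, so the speed of the angle can be read off from the
derivative of the projection. -/
theorem eq_of_smul_reflMatrixDeriv_eq {a b θ : ℝ}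
    (h : (1 / 2 * (a : ℂ)) • reflMatrixDeriv θ = (1 / 2 * (b : ℂ)) • reflMatrixDeriv θ) :
    a = b := by
  have h0 := congrFun (congrFun h 0) 0
  have h1 := congrFun (congrFun h 0) 1
  simp [reflMatrixDeriv, -Complex.ofReal_cos, -Complex.ofReal_sin] at h0 h1
  have h2 := Real.sin_sq_add_cos_sq θ
  rcases h0 with h0 | h0
  · exact_mod_cast h0
  rcases h1 with h1 | h1
  · exact_mod_cast h1
  have h0' : Real.sin θ = 0 := by exact_mod_cast h0
  have h1' : Real.cos θ = 0 := by exact_mod_cast h1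
  simp [h0', h1'] at h2

/-- The system for the projection onto the line of angle `f` is the Bäcklund system for `f`. -/
theorem isProjectionSystem_angleProj_iff (hq : IsSineGordon q) (hs : s ≠ 0)
    {g : ℝ → ℝ → Matrix (Fin 2) (Fin 2) ℂ} (hg : IsSineGordonFrame q g)
    (hfx : ∀ t, Differentiable ℝ fun x => f x t) (hft : ∀ x, Differentiable ℝ fun t => f x t) :
    IsProjectionSystem sgA sgB (sgPotential q) g (Complex.I * (s : ℂ)) (angleProj (f 0 0))
      (fun x t => angleProj (f x t)) ↔ IsBacklundAngle s q f := by
  constructor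
  · intro h
    refine ⟨fun x t => ?_, fun x t => ?_⟩
    · have h1 := h.deriv_x x t
      rw [sgPotential_eq, projection_x] at h1
      have h2 := (hfx t x).hasDerivAt
      exact h2.congr_deriv (eq_of_smul_reflMatrixDeriv_eq ((hasMatDerivAt_angleProj h2).unique h1))
    · have h1 := h.deriv_t x t
      rw [hg.conj_eq hq, projection_t hs] at h1
      have h2 := (hft x t).hasDerivAt
      exact h2.congr_deriv (eq_of_smul_reflMatrixDeriv_eq ((hasMatDerivAt_angleProj h2).unique h1))
  · intro h
    refine ⟨fun x t => ?_, fun x t => ?_, fun x t => angleProj_conjTranspose _,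
      fun x t => angleProj_mul_self _, rfl⟩
    · rw [sgPotential_eq, projection_x]
      exact hasMatDerivAt_angleProj (h.deriv_x x t)
    · rw [hg.conj_eq hq, projection_t hs]
      exact hasMatDerivAt_angleProj (h.deriv_t x t)

section

attribute [local instance] Matrix.normedAddCommGroup Matrix.normedSpace

/-- Uniqueness for the linear equation `D' = D B + C D`. -/
theorem eq_zero_of_hasMatDerivAt {n : Type*} [Fintype n] {D B C : ℝ → Matrix n n ℂ}
    (hB : Continuous B) (hC : Continuous C)
    (hD : ∀ x, HasMatDerivAt D (D x * B x + C x * D x) x) (h0 : D 0 = 0) (x : ℝ) : D x = 0 := by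
  refine eq_zero_of_norm_deriv_le (fun x => hasMatDerivAt_iff.mp (hD x)) h0 (fun R => ?_) x
  obtain ⟨b, hb0, hb⟩ := exists_bound_abs_le hB R
  obtain ⟨c, hc0, hc⟩ := exists_bound_abs_le hC R
  refine ⟨Fintype.card n * (b + c), fun x hx => ?_⟩
  calc ‖D x * B x + C x * D x‖
      ≤ Fintype.card n * (‖D x‖ * ‖B x‖) + Fintype.card n * (‖C x‖ * ‖D x‖) :=
        (norm_add_le _ _).trans (add_le_add (norm_matrix_mul_le _ _) (norm_matrix_mul_le _ _))
    _ ≤ Fintype.card n * (‖D x‖ * b) + Fintype.card n * (c * ‖D x‖) := by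
        gcongr
        · exact hb x hx
        · exact hc x hx
    _ = _ := by ring

theorem continuous_of_hasMatDerivAt {n : Type*} [Fintype n] {F F' : ℝ → Matrix n n ℂ}
    (h : ∀ x, HasMatDerivAt F (F' x) x) : Continuous F :=
  continuous_iff_continuousAt.mpr fun x => (hasMatDerivAt_iff.mp (h x)).continuousAt

end

/-- The quadratic terms are handled by PXP - P'XP' = DXP + P'XD with D = P - P', so D solves a
linear homogeneous equation whose coefficients involve the known P and P'. It vanishes along x = 0,
then along every horizontal line. -/
theorem IsProjectionSystem.unique {n : Type*} [Fintype n] [DecidableEq n] {a b : Matrix n n ℂ}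
    {u g : ℝ → ℝ → Matrix n n ℂ} {z : ℂ} {p : Matrix n n ℂ} {P P' : ℝ → ℝ → Matrix n n ℂ}
    (hu : ∀ t, Continuous fun x => u x t)
    (hQ : Continuous fun t => (g 0 t)⁻¹ * b * g 0 t)
    (hP : IsProjectionSystem a b u g z p P) (hP' : IsProjectionSystem a b u g z p P') : P = P' := by
  have hPx : ∀ t, Continuous fun x => P x t := fun t =>
    continuous_of_hasMatDerivAt fun x => hP.deriv_x x t
  have hPx' : ∀ t, Continuous fun x => P' x t := fun t =>
    continuous_of_hasMatDerivAt fun x => hP'.deriv_x x t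
  have hPt : Continuous fun t => P 0 t := continuous_of_hasMatDerivAt fun t => hP.deriv_t 0 t
  have hPt' : Continuous fun t => P' 0 t := continuous_of_hasMatDerivAt fun t => hP'.deriv_t 0 t
  have ht : ∀ t, P 0 t - P' 0 t = 0 := by
    set Q := fun t => (g 0 t)⁻¹ * b * g 0 t with hQdef
    set r := (((‖z‖ ^ 2 : ℝ) : ℂ))⁻¹ with hr
    refine eq_zero_of_hasMatDerivAt (D := fun t => P 0 t - P' 0 t)
      (B := fun t => r • ((z - star z) • (Q t * P 0 t) + star z • Q t))
      (C := fun t => r • ((z - star z) • (P' 0 t * Q t) - z • Q t)) (by fun_prop) (by fun_prop)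
      (fun t => ((hP.deriv_t 0 t).sub (hP'.deriv_t 0 t)).congr_deriv ?_)
      (by simp [hP.base, hP'.base])
    have : (g 0 t)⁻¹ * b * g 0 t = Q t := rfl
    rw [this]
    simp only [mul_add, mul_sub, sub_mul, smul_mul_assoc, mul_smul_comm, smul_add,
      smul_sub, sub_smul, mul_assoc]
    abel
  funext x t
  refine sub_eq_zero.mp (eq_zero_of_hasMatDerivAt (D := fun x => P x t - P' x t)
    (B := fun x => (star z - z) • (a * P x t) + (z • a + u x t))
    (C := fun x => (star z - z) • (P' x t * a - a) - (z • a + u x t)) ?_ ?_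
    (fun x => ((hP.deriv_x x t).sub (hP'.deriv_x x t)).congr_deriv ?_) (ht t) x)
  · have := hu t; have := hPx t; fun_prop
  · have := hu t; have := hPx' t; fun_prop
  · have e1 : (P x t * a - a * P x t) * P x t = P x t * a * P x t - a * P x t := by
      rw [sub_mul, mul_assoc a, hP.idempotent]
    have e2 : (P' x t * a - a * P' x t) * P' x t = P' x t * a * P' x t - a * P' x t := by
      rw [sub_mul, mul_assoc a, hP'.idempotent]
    rw [e1, e2]
    generalize z • a + u x t = A
    simp only [mul_add, mul_sub, sub_mul, smul_mul_assoc, mul_smul_comm, smul_sub, sub_smul,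
      mul_assoc]
    abel

end ProjectionSystem

end LoopSG

/-- For a sine-Gordon solution `q` with potential `u`, the classical Bäcklund transform `qs` of `q`
exists and is unique, and its potential is `g_{is,π} ∗ u`, where `π` is the Hermitian projection
onto `(cos (f₀/2), sin (f₀/2))`; the system for the projection reduces to the classical one. -/
theorem proposition5p19 (q : ℝ → ℝ → ℝ) (hq : IsSineGordon q) (s : ℝ) (hs : s ≠ 0) (c₀ : ℝ)
    (f₀ : ℝ) (hf₀ : f₀ = (q 0 0 + c₀) / 2) (z : ℂ) (hz : z = Complex.I * (s : ℂ)) :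
    -- `π` is the projection onto the line, and `g_{is,π}` is a twisted rational loop
    IsHermitianProjectionOnto (angleProj f₀) (angleLine f₀) ∧
    IsTwistedRationalLoop (simpleElement z (angleProj f₀)) ∧
    -- `u` is a solution of the twisted `-1` flow
    (∀ x t, sgPotential q x t ∈ twistedPerp sgA) ∧
    IsSineGordonFrame q (sgFrame q) ∧
    (VanishesAtBot q → ∃ g, IsSineGordonFrame q g ∧ IsNormalizedFrame g) ∧
    ∃ qs : ℝ → ℝ → ℝ,
      -- `qs` is the classical Bäcklund transform of `q`
      IsClassicalBacklund s c₀ q qs ∧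
      (∀ r, IsClassicalBacklund s c₀ q r → r = qs) ∧
      IsSineGordon qs ∧
      ∀ g, IsSineGordonFrame q g →
        -- the potential of `qs` is `g_{is,π} ∗ u`
        IsDressing sgA sgB (sgPotential q) g (simpleElement z (angleProj f₀)) (sgPotential qs) ∧
        (∀ v, IsDressing sgA sgB (sgPotential q) g (simpleElement z (angleProj f₀)) v →
          v = sgPotential qs) ∧
        -- the projection onto `E(x,t,z)^*(π(ℂ²))` is the one of angle `(qs + q)/2`
        (∀ E, IsTrivialization sgA sgB (sgPotential q) g E → ∀ x t,
          IsHermitianProjectionOnto (angleProj ((qs x t + q x t) / 2))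
            ((angleLine f₀).map (Matrix.toLin' (E x t z).conjTranspose))) ∧
        (∀ x t, sgPotential qs x t = sgPotential q x t + (z - star z) •
          (angleProj ((qs x t + q x t) / 2) * sgA - sgA * angleProj ((qs x t + q x t) / 2))) ∧
        -- it is the unique solution of the system for the projection
        IsProjectionSystem sgA sgB (sgPotential q) g z (angleProj f₀)
          (fun x t => angleProj ((qs x t + q x t) / 2)) ∧
        (∀ P, IsProjectionSystem sgA sgB (sgPotential q) g z (angleProj f₀) P →
          P = fun x t => angleProj ((qs x t + q x t) / 2)) ∧
        -- which reduces to the classical system for `2 f - q`, `f` the angle of the projection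
        (∀ f : ℝ → ℝ → ℝ, (∀ t, Differentiable ℝ (fun x => f x t)) →
          (∀ x, Differentiable ℝ (fun t => f x t)) → f 0 0 = f₀ →
          (IsProjectionSystem sgA sgB (sgPotential q) g z (angleProj f₀)
              (fun x t => angleProj (f x t)) ↔
            IsClassicalBacklund s c₀ q (fun x t => 2 * f x t - q x t))) := by
  subst hf₀ hz
  obtain ⟨f, hf, hf0⟩ := hq.exists_isBacklundAngle hs ((q 0 0 + c₀) / 2)
  have hcb : IsClassicalBacklund s c₀ q (fun x t => 2 * f x t - q x t) :=
    (isClassicalBacklund_iff hq hs).mpr ⟨hf, by rw [hf0]; ring⟩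
  have hangle : ∀ x t, ((2 * f x t - q x t) + q x t) / 2 = f x t := fun x t => by ring
  refine ⟨isHermitianProjectionOnto_angleProj _, isTwistedRationalLoop_simpleElement s _,
    sgPotential_mem_twistedPerp q, isSineGordonFrame_sgFrame hq, exists_normalized_frame hq,
    fun x t => 2 * f x t - q x t, hcb, fun r hr => ?_, hf.isSineGordon hs hq, fun g hg => ?_⟩
  -- Any competitor r is rewritten through its angle (r + q)/2, so uniqueness of angles applies.
  · have hr' : r = fun x t => 2 * ((r x t + q x t) / 2) - q x t := by
      funext x t; ring
    rw [hr'] at hr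
    have h := (isClassicalBacklund_iff hq hs).mp hr
    have hrf := h.1.unique hf (by rw [hf0]; linarith [h.2])
    rw [hr', ← hrf]
  · simp only [hangle]
    rw [← hf0]
    have hsys := (isProjectionSystem_angleProj_iff hq hs hg
      (fun t x => (hf.deriv_x x t).differentiableAt)
      (fun x t => (hf.deriv_t x t).differentiableAt)).mpr hf
    refine ⟨hf.isDressing hq hs hg, fun v hv => hf.isDressing_unique hq hs hg hv,
      fun E hE x t => hf.isHermitianProjectionOnto hq hs ((hg.isTrivialization_iff hq).mp hE) x t,
      sgPotential_transform hf hq, hsys,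
      fun P hP => hP.unique hq.continuous_sgPotential ?_ hsys, fun f' hfx hft h0 => ?_⟩
    · simp only [hg.conj_eq hq]
      exact continuous_sgQ.comp (hq.smooth.continuous.comp
        (by fun_prop : Continuous fun t : ℝ => ((0 : ℝ), t)))
    · rw [isClassicalBacklund_iff hq hs, ← h0, isProjectionSystem_angleProj_iff hq hs hg hfx hft]
      exact ⟨fun h => ⟨h, by rw [h0, hf0]; ring⟩, fun h => h.1⟩
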